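/- Let $k\ge 2$ be an integer. For $n\ge 0$ with base-$k$ expansion $n=i_0+i_1k+\cdots+i_sk^s$ (digits $0\le i_j\le k-1$), put $$\kappa(n):=\begin{pmatrix}1&0\end{pmatrix}A_{i_0}A_{i_1}\cdots A_{i_s}\begin{pmatrix}1\\0\end{pmatrix},\qquad A_i:=\begin{pmatrix} i+1&1\\1&0\end{pmatrix}\quad(0\le i\le k-1),$$ so that $\kappa(0)=1$, and let $K(z):=\sum_{n\ge 0}\kappa(n)z^n$. **Theorem.** For every integer $k\ge 2$, the power series $K(z)$ converges for $|z|<1$, and the functions $K(z)$ and $K(z^k)$ on the open unit disc are algebraically independent over the field $\mathbb{C}(z)$ of rational functions. -/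

import Mathlib

open Filter Matrix

/-- The matrix `A_i` with rows `(i + 1, 1)` and `(1, 0)`. -/
def zarembaMatrix (i : ℕ) : Matrix (Fin 2) (Fin 2) ℤ :=
  !![(i : ℤ) + 1, 1; 1, 0]

/-- `κ(n) = [1 0] A_{i₀} A_{i₁} ⋯ A_{i_s} [1 0]ᵀ`, where `n = i₀ + i₁ k + ⋯ + i_s k ^ s` in base `k`
(`Nat.digits` lists the digits with the least significant one first; `κ(0) = 1`). -/
def kappa (k n : ℕ) : ℤ :=
  ![1, 0] ⬝ᵥ (((Nat.digits k n).map zarembaMatrix).prod *ᵥ ![1, 0])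

/-- The generating function `K(z) = ∑ κ(n) zⁿ`, a function on the open unit disc. -/
noncomputable def zarembaK (k : ℕ) (z : ℂ) : ℂ :=
  ∑' n : ℕ, (kappa k n : ℂ) * z ^ n

/-- Complex-valued functions on the open unit disc, where two functions are identified when they
agree off a subset of the disc without accumulation points in the disc. Functions that are
meromorphic on the disc, rational functions in particular, are elements of this ring. -/
abbrev DiscFunction : Type :=
  Germ (codiscreteWithin (Metric.ball (0 : ℂ) 1)) ℂ

theorem eventually_denom_ne_zero (r : RatFunc ℂ) :
    ∀ᶠ z in codiscreteWithin (Metric.ball (0 : ℂ) 1),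
      Polynomial.eval₂ (RingHom.id ℂ) z r.denom ≠ 0 := by
  have hfin : {z : ℂ | Polynomial.eval₂ (RingHom.id ℂ) z r.denom = 0}.Finite := by
    refine (r.denom.roots.toFinset.finite_toSet).subset fun z hz => ?_
    simp only [Set.mem_ofPred_eq, Polynomial.eval₂_id] at hz
    simpa [RatFunc.denom_ne_zero] using hz
  exact compl_finite_mem_codiscreteWithin hfin

/-- A rational function `r ∈ ℂ(z)`, as a function on the unit disc (off its poles). -/
noncomputable def ratFuncToDisc : RatFunc ℂ →+* DiscFunction where
  toFun r := ((fun z : ℂ => r.eval (RingHom.id ℂ) z : ℂ → ℂ) : DiscFunction)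
  map_one' := by
    refine Germ.coe_eq.2 (Eventually.of_forall fun z => ?_)
    simp [RatFunc.eval_one]
  map_zero' := by
    refine Germ.coe_eq.2 (Eventually.of_forall fun z => ?_)
    simp [RatFunc.eval_zero]
  map_mul' r s := by
    refine Germ.coe_eq.2 ?_
    filter_upwards [eventually_denom_ne_zero r, eventually_denom_ne_zero s] with z hr hs
    simpa using RatFunc.eval_mul (RingHom.id ℂ) z hr hs
  map_add' r s := by
    refine Germ.coe_eq.2 ?_
    filter_upwards [eventually_denom_ne_zero r, eventually_denom_ne_zero s] with z hr hs
    simpa using RatFunc.eval_add (RingHom.id ℂ) z hr hs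

/-- Functions on the unit disc as an algebra over `ℂ(z)`. -/
noncomputable instance discFunctionAlgebra : Algebra (RatFunc ℂ) DiscFunction :=
  ratFuncToDisc.toAlgebra

/-!
Write `Q = ∑_{i < k} zⁱ`, `P = ∑_{i < k} (i + 1) zⁱ` and `M(z) = Q(z) K(z ^ k) - 1`. Splitting off
the last digit of `n` gives the Mahler system

  `K(z) = P(z) K(z ^ k) + Q(z) M(z ^ k)`,  `M(z) = Q(z) K(z ^ k) - 1`,

whose linear part is `A(z) = ∑_{i < k} zⁱ Aᵢ`. Over `ℂ(z)` the pairs `(K(z), K(z ^ k))` and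
`(K(z), M(z))` differ by an invertible affine substitution, so it suffices to show that `K` and `M`
are algebraically independent.

*Transcendence of `K`* (`zarembaK_transcendental`). As `κ(n) ≥ 1`, the vector `(K, M)` is radially
unbounded at the nontrivial `k`-th roots of unity, and this propagates from `ξ ^ k` to `ξ` through
the matrix `A(ξ)`, which is invertible when `ξ ^ k ≠ 1`. The leading coefficient `a` of an algebraic
relation for `K` would thus satisfy `a(ξ) a(ξ ^ k) = 0` at infinitely many roots of unity.

*The ideal of relations.* Suppose that the ideal of relations between `M` and `K` over `ℂ[z]` is not
zero. It is prime, by the identity theorem, and because `K` is transcendental it is generated by a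
single prime element `p` (`prime_dvd_of_mem_relationIdeal`). Substituting the Mahler system into `p`
gives a relation between `M(z ^ k)` and `K(z ^ k)` over `ℂ[z]`; sorting by the residues of the
exponents of `z` modulo `k` turns it into relations between `M` and `K`, hence into multiples of
`p`. For degree reasons the substituted polynomial is `c(z) p(z ^ k; M, K)` with `c ∈ ℂ[z]`
(`exists_eq_C_mul_map_expand`). The leading form `H` of `p` therefore satisfies
`H(z; A(z) x) = c(z) H(z ^ k; x)`.

*No such form exists* (`no_semiinvariant_form`). One may assume that `H(1; ·)` is not zero. Its
zeros are carried along by the nonnegative matrix `A(1)`, so that neither coordinate vector is a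
zero (`binaryForm_coeff_ne_zero`). Evaluating at the two coordinate vectors then shows that `c` is
divisible by `Q ^ d` and that the quotient still vanishes at a root of unity, where `d` is the
degree of `H`. So `c` has degree larger than `d (k - 1)`, while comparing degrees in `z` on both
sides of the functional equation bounds its degree by `d (k - 1)`.
-/

namespace Zaremba

open Polynomial Topology

/-! ### The polynomials of the Mahler system -/

/-- The polynomial `Q = ∑_{i < k} zⁱ`, the off-diagonal entry of `A(z) = ∑_{i < k} zⁱ Aᵢ`. -/
noncomputable def digitPoly (k : ℕ) : ℂ[X] := ∑ i ∈ Finset.range k, X ^ i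

/-- The polynomial `P = ∑_{i < k} (i + 1) zⁱ`, the upper left entry of `A(z) = ∑_{i < k} zⁱ Aᵢ`. -/
noncomputable def weightPoly (k : ℕ) : ℂ[X] := ∑ i ∈ Finset.range k, C ((i : ℂ) + 1) * X ^ i

theorem digitPoly_mul (k : ℕ) : digitPoly k * (X - C 1) = X ^ k - 1 := by
  simpa [digitPoly] using geom_sum_mul (X : ℂ[X]) k

theorem weightPoly_mul (k : ℕ) :
    weightPoly k * (X - C 1) = C (k : ℂ) * X ^ k - digitPoly k := by
  induction k with
  | zero => simp [weightPoly, digitPoly]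
  | succ n ih =>
    have h1 : weightPoly (n + 1) = weightPoly n + C ((n : ℂ) + 1) * X ^ n := by
      simp [weightPoly, Finset.sum_range_succ]
    have h2 : digitPoly (n + 1) = digitPoly n + X ^ n := by
      simp [digitPoly, Finset.sum_range_succ]
    rw [h1, h2, add_mul, ih]
    push_cast
    simp only [C_add, C_1]
    ring

theorem digitPoly_monic {k : ℕ} (hk : k ≠ 0) : (digitPoly k).Monic :=
  Polynomial.monic_geom_sum_X hk

theorem natDegree_digitPoly {k : ℕ} (hk : k ≠ 0) : (digitPoly k).natDegree = k - 1 := by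
  have h := congrArg natDegree (digitPoly_mul k)
  rw [(digitPoly_monic hk).natDegree_mul (monic_X_sub_C 1), natDegree_X_sub_C,
    show (X ^ k - 1 : ℂ[X]) = X ^ k - C 1 by simp, natDegree_X_pow_sub_C] at h
  omega

theorem natDegree_weightPoly_le (k : ℕ) : (weightPoly k).natDegree ≤ k - 1 := by
  refine natDegree_sum_le_of_forall_le _ _ fun i hi => ?_
  have := Finset.mem_range.1 hi
  exact (natDegree_C_mul_X_pow_le _ _).trans (by omega)

theorem eval_digitPoly_eq_zero {k : ℕ} {z : ℂ} (hz : z ^ k = 1) (h1 : z ≠ 1) :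
    (digitPoly k).eval z = 0 := by
  have h := congrArg (eval z) (digitPoly_mul k)
  simp only [eval_mul, eval_sub, eval_X, eval_C, eval_pow, eval_one, hz, sub_self] at h
  exact (mul_eq_zero.1 h).resolve_right (sub_ne_zero.2 h1)

theorem eval_digitPoly_ne_zero {k : ℕ} {z : ℂ} (hz : z ^ k ≠ 1) :
    (digitPoly k).eval z ≠ 0 := by
  intro h0
  have h := congrArg (eval z) (digitPoly_mul k)
  simp only [eval_mul, eval_sub, eval_X, eval_C, eval_pow, eval_one, h0, zero_mul] at h
  exact hz (sub_eq_zero.1 h.symm)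

theorem eval_weightPoly_ne_zero {k : ℕ} (hk : k ≠ 0) {z : ℂ} (hz : z ^ k = 1) (h1 : z ≠ 1) :
    (weightPoly k).eval z ≠ 0 := by
  intro h0
  have h := congrArg (eval z) (weightPoly_mul k)
  simp only [eval_mul, eval_sub, eval_X, eval_C, eval_pow, hz,
    eval_digitPoly_eq_zero hz h1, h0, zero_mul] at h
  simp at h
  exact hk (by exact_mod_cast h.symm)

theorem eval_one_digitPoly (k : ℕ) : (digitPoly k).eval 1 = k := by
  simp [digitPoly, eval_finsetSum]

theorem eval_one_weightPoly (k : ℕ) :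
    (weightPoly k).eval 1 = ((∑ i ∈ Finset.range k, ((i : ℝ) + 1) : ℝ) : ℂ) := by
  simp [weightPoly, eval_finsetSum]

/-! ### Semi-invariant binary forms -/

/-- The zeros `ρ ≥ 0` of `H(1, ρ)` form a finite set on which the injective map
`ρ ↦ q / (p + q ρ)` acts, hence acts bijectively; as `0` is not a value of that map, it is not a
zero. The vector `(0, 1)` is mapped to a multiple of `(1, 0)`, so it is not a zero of `H` either. -/
theorem binaryForm_coeff_ne_zero {d : ℕ} {b : ℕ → ℂ} {p q : ℝ} (hp : 0 < p) (hq : 0 < q)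
    (hb : ∃ j ≤ d, b j ≠ 0) {e : ℂ}
    (h : ∀ u v : ℂ, ∑ j ∈ Finset.range (d + 1), b j * (p * u + q * v) ^ j * (q * u) ^ (d - j) =
      e * ∑ j ∈ Finset.range (d + 1), b j * (u ^ j * v ^ (d - j))) :
    b d ≠ 0 ∧ b 0 ≠ 0 := by
  set H : ℂ → ℂ → ℂ := fun u v => ∑ j ∈ Finset.range (d + 1), b j * (u ^ j * v ^ (d - j)) with hH
  have hinv : ∀ u v : ℂ, H (p * u + q * v) (q * u) = e * H u v := by
    intro u v
    rw [← h u v]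
    exact Finset.sum_congr rfl fun j _ => by ring
  have hscale : ∀ s u v : ℂ, H (s * u) (s * v) = s ^ d * H u v := by
    intro s u v
    simp only [hH, Finset.mul_sum]
    refine Finset.sum_congr rfl fun j hj => ?_
    have : d = j + (d - j) := by have := Finset.mem_range.1 hj; omega
    rw [mul_pow, mul_pow]
    nth_rewrite 3 [this]
    rw [pow_add]
    ring
  set g : ℂ[X] := ∑ j ∈ Finset.range (d + 1), C (b j) * X ^ (d - j) with hg
  have hgeval : ∀ x : ℂ, g.eval x = H 1 x := by
    intro x
    simp [hg, hH, eval_finsetSum]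
  have hg0 : g ≠ 0 := by
    obtain ⟨j, hj, hbj⟩ := hb
    intro h0
    have := congrArg (fun f => coeff f (d - j)) h0
    simp only [hg, finsetSum_coeff, coeff_C_mul, coeff_X_pow, coeff_zero] at this
    rw [Finset.sum_eq_single j] at this
    · simp at this; exact hbj this
    · intro i hi hij
      have := Finset.mem_range.1 hi
      rw [if_neg (by omega)]; simp
    · intro hn; exact absurd (Finset.mem_range.2 (by omega)) hn
  set T : Set ℝ := {x | 0 ≤ x ∧ H 1 (x : ℂ) = 0} with hT
  have hTfin : T.Finite := by
    have h1 : (g.roots.toFinset : Set ℂ).Finite := Finset.finite_toSet _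
    refine (h1.preimage (f := fun x : ℝ => (x : ℂ)) Complex.ofReal_injective.injOn).subset ?_
    intro x hx
    simp only [Set.mem_preimage, Finset.mem_coe, Multiset.mem_toFinset]
    rw [mem_roots hg0, IsRoot, hgeval]
    exact hx.2
  have hmaps : Set.MapsTo (fun x : ℝ => q / (p + q * x)) T T := by
    rintro x ⟨hx0, hx⟩
    have hpos : 0 < p + q * x := by positivity
    refine ⟨by positivity, ?_⟩
    have h1 := hinv 1 x
    rw [hx, mul_zero] at h1
    have hne : ((p + q * x : ℝ) : ℂ) ≠ 0 := by exact_mod_cast hpos.ne'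
    have h2 := hscale ((p + q * x : ℝ) : ℂ) 1 ((q / (p + q * x) : ℝ) : ℂ)
    have h3 : ((p + q * x : ℝ) : ℂ) * ((q / (p + q * x) : ℝ) : ℂ) = q * 1 := by
      rw [← Complex.ofReal_mul, mul_div_cancel₀ _ hpos.ne', mul_one]
    have h4 : ((p + q * x : ℝ) : ℂ) * 1 = p * 1 + q * x := by push_cast; ring
    rw [h3, h4, h1] at h2
    exact (mul_eq_zero.1 h2.symm).resolve_left (pow_ne_zero _ hne)
  have hinj : Set.InjOn (fun x : ℝ => q / (p + q * x)) T := by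
    rintro x ⟨hx0, -⟩ y ⟨hy0, -⟩ hxy
    have hx : 0 < p + q * x := by positivity
    have hy : 0 < p + q * y := by positivity
    simp only at hxy
    rw [div_eq_div_iff hx.ne' hy.ne'] at hxy
    have h5 := mul_left_cancel₀ hq.ne' hxy
    have h6 : q * y = q * x := by linarith
    exact (mul_left_cancel₀ hq.ne' h6).symm
  have hd : H 1 0 ≠ 0 := by
    intro h0
    have hmem : (0 : ℝ) ∈ T := ⟨le_rfl, by simpa using h0⟩
    obtain ⟨x, ⟨hx0, -⟩, hx⟩ := ((hTfin.injOn_iff_bijOn_of_mapsTo hmaps).1 hinj).surjOn hmem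
    have hpos : 0 < q / (p + q * x) := by positivity
    exact hpos.ne' hx
  have hH10 : H 1 0 = b d := by
    simp only [hH]
    rw [Finset.sum_range_succ, Finset.sum_eq_zero]
    · simp
    · intro j hj
      have := Finset.mem_range.1 hj
      rw [zero_pow (by omega)]; simp
  have hH01 : H 0 1 = b 0 := by
    simp only [hH]
    rw [Finset.sum_range_succ', Finset.sum_eq_zero]
    · simp
    · intro j _; simp
  refine ⟨hH10 ▸ hd, fun h0 => hd ?_⟩
  have h1 := hinv 0 1
  rw [hH01, h0] at h1
  have h2 := hscale q 1 0
  simp only [mul_zero, zero_add] at h1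
  rw [mul_zero (q : ℂ), h1] at h2
  exact (mul_eq_zero.1 h2.symm).resolve_left (pow_ne_zero _ (by exact_mod_cast hq.ne'))

/-- Evaluating a semi-invariant form at `(0, 1)` and at `(1, 0)` over a root of unity `ζ ≠ 1` with
`ζ ^ k = 1` shows that the multiplier `c` is divisible by `Q ^ d`, with a quotient that vanishes at
`ζ`. The degree in `z` of both sides forbids this. -/
theorem no_semiinvariant_form_of_eval_one {k : ℕ} (hk : 2 ≤ k) {d : ℕ} (hd : 1 ≤ d)
    {a : ℕ → ℂ[X]} (ha : ∃ j ≤ d, (a j).eval 1 ≠ 0) {c : ℂ[X]}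
    (h : ∀ u v : ℂ, ∑ j ∈ Finset.range (d + 1), a j *
        (weightPoly k * C u + digitPoly k * C v) ^ j * (digitPoly k * C u) ^ (d - j) =
      c * ∑ j ∈ Finset.range (d + 1), expand ℂ k (a j) * C (u ^ j * v ^ (d - j))) : False := by
  have hk0 : k ≠ 0 := by omega
  have hQ0 : digitPoly k ≠ 0 := (digitPoly_monic hk0).ne_zero
  have hend : (a d).eval 1 ≠ 0 ∧ (a 0).eval 1 ≠ 0 := by
    refine binaryForm_coeff_ne_zero (b := fun j => (a j).eval 1) (e := c.eval 1)
      (p := ∑ i ∈ Finset.range k, ((i : ℝ) + 1)) (q := k) ?_ (by positivity) ha ?_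
    · exact Finset.sum_pos (fun i _ => by positivity) ⟨0, by simp; omega⟩
    · intro u v
      have h1 := congrArg (eval 1) (h u v)
      simp only [eval_finsetSum, eval_mul, eval_pow, eval_add, eval_C, expand_eval, one_pow,
        eval_one_weightPoly, eval_one_digitPoly] at h1
      exact_mod_cast h1
  -- the point `(0, 1)`
  have h01 : a d * digitPoly k ^ d = c * expand ℂ k (a 0) := by
    have h1 := h 0 1
    simp only [map_zero, mul_zero, zero_add, map_one, mul_one] at h1
    rw [Finset.sum_range_succ, Finset.sum_eq_zero, Finset.sum_range_succ', Finset.sum_eq_zero] at h1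
    · simpa using h1
    · intro j _; simp
    · intro j hj
      have := Finset.mem_range.1 hj
      rw [zero_pow (n := d - j) (by omega), mul_zero]
  -- `a 0 (z ^ k)` is a nonzero constant modulo `z ^ k - 1`, hence prime to `Q`
  have hcop : IsCoprime (digitPoly k) (expand ℂ k (a 0)) := by
    obtain ⟨s, hs⟩ := X_sub_C_dvd_sub_C_eval (a := (1 : ℂ)) (p := a 0)
    have h2 := congrArg (expand ℂ k) hs
    simp only [map_sub, expand_C, map_mul, expand_X] at h2
    rw [map_one, ← digitPoly_mul] at h2
    refine ⟨-(C ((a 0).eval 1)⁻¹ * (X - C 1) * expand ℂ k s), C ((a 0).eval 1)⁻¹, ?_⟩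
    have h3 : C ((a 0).eval 1)⁻¹ * C ((a 0).eval 1) = 1 := by
      rw [← C_mul, inv_mul_cancel₀ hend.2, C_1]
    linear_combination C ((a 0).eval 1)⁻¹ * h2 + h3
  obtain ⟨c', rfl⟩ : digitPoly k ^ d ∣ c :=
    (hcop.pow_left).dvd_of_dvd_mul_right (Dvd.intro_left _ h01)
  have hc' : a d = c' * expand ℂ k (a 0) := by
    refine mul_right_cancel₀ (pow_ne_zero d hQ0) ?_
    rw [h01]; ring
  have hc'0 : c' ≠ 0 := by
    rintro rfl
    rw [zero_mul] at hc'
    simp [hc'] at hend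
  -- the point `(1, 0)`, over a nontrivial root of unity
  obtain ⟨ζ, hζ⟩ : ∃ ζ : ℂ, IsPrimitiveRoot ζ k := ⟨_, Complex.isPrimitiveRoot_exp k hk0⟩
  have hζ1 : ζ ≠ 1 := hζ.ne_one (by omega)
  have hζk : ζ ^ k = 1 := hζ.pow_eq_one
  have hQζ := eval_digitPoly_eq_zero hζk hζ1
  have hadζ : (a d).eval ζ = 0 := by
    have h1 := congrArg (eval ζ) (h 1 0)
    simp only [map_zero, mul_zero, add_zero, map_one, mul_one, eval_finsetSum, eval_mul, eval_pow,
      hQζ, zero_pow (by omega : d ≠ 0), zero_mul] at h1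
    rw [Finset.sum_range_succ, Finset.sum_eq_zero] at h1
    · simpa [eval_weightPoly_ne_zero hk0 hζk hζ1] using h1
    · intro j hj
      have := Finset.mem_range.1 hj
      rw [zero_pow (n := d - j) (by omega), mul_zero]
  have hc'ζ : c'.eval ζ = 0 := by
    rw [hc', eval_mul, expand_eval, hζk] at hadζ
    exact (mul_eq_zero.1 hadζ).resolve_right hend.2
  have hc'deg : 1 ≤ c'.natDegree := by
    by_contra hlt
    rw [eq_C_of_natDegree_eq_zero (by omega : c'.natDegree = 0), eval_C] at hc'ζ
    rw [eq_C_of_natDegree_eq_zero (by omega : c'.natDegree = 0), hc'ζ] at hc'0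
    simp at hc'0
  -- compare degrees in `z` at a point `(u, 1)` where the form keeps its full degree
  set n := (Finset.range (d + 1)).sup fun j => (a j).natDegree with hn
  have hle : ∀ j ∈ Finset.range (d + 1), (a j).natDegree ≤ n := fun j hj =>
    Finset.le_sup (f := fun j => (a j).natDegree) hj
  obtain ⟨j₀, hj₀, hj₀n⟩ := Finset.exists_mem_eq_sup (Finset.range (d + 1)) ⟨0, by simp⟩
    fun j => (a j).natDegree
  obtain ⟨u, hu⟩ : ∃ u : ℂ, ∑ j ∈ Finset.range (d + 1), (a j).coeff n * u ^ j ≠ 0 := by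
    by_contra! hall
    set g : ℂ[X] := ∑ j ∈ Finset.range (d + 1), C ((a j).coeff n) * X ^ j with hg
    have hg0 : g = 0 := by
      refine Polynomial.funext fun x => ?_
      simpa [hg, eval_finsetSum] using hall x
    have hall' : ∀ j ∈ Finset.range (d + 1), (a j).coeff n = 0 := by
      intro j hj
      have h1 := congrArg (fun f => coeff f j) hg0
      simp only [hg, finsetSum_coeff, coeff_C_mul, coeff_X_pow, coeff_zero] at h1
      simpa [Finset.mem_range.1 hj] using h1
    have h2 : a j₀ = 0 := by
      rw [← leadingCoeff_eq_zero, leadingCoeff, ← hj₀n]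
      exact hall' j₀ hj₀
    have hn0 : n = 0 := by rw [hn, hj₀n, h2, natDegree_zero]
    have h3 := hall' d (by simp)
    have h4 := hle d (by simp)
    rw [hn0] at h3 h4
    rw [eq_C_of_natDegree_le_zero h4, h3] at hend
    simp at hend
  set f : ℂ[X] := ∑ j ∈ Finset.range (d + 1), a j * C (u ^ j) with hf
  have hfdeg : n ≤ f.natDegree := by
    refine le_natDegree_of_ne_zero ?_
    simpa only [hf, finsetSum_coeff, coeff_mul_C] using hu
  have hf0 : f ≠ 0 := by
    rintro h0
    apply hu
    have := congrArg (fun f => coeff f n) h0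
    simpa only [hf, finsetSum_coeff, coeff_mul_C, coeff_zero] using this
  have hR : digitPoly k ^ d * c' * ∑ j ∈ Finset.range (d + 1),
      expand ℂ k (a j) * C (u ^ j * 1 ^ (d - j)) = digitPoly k ^ d * c' * expand ℂ k f := by
    simp [hf]
  have hRdeg : (digitPoly k ^ d * c' * expand ℂ k f).natDegree =
      d * (k - 1) + c'.natDegree + f.natDegree * k := by
    rw [natDegree_mul (mul_ne_zero (pow_ne_zero _ hQ0) hc'0)
      ((expand_ne_zero (by omega)).2 hf0), natDegree_mul (pow_ne_zero _ hQ0) hc'0,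
      natDegree_pow, natDegree_digitPoly hk0, natDegree_expand]
  have hLdeg : (∑ j ∈ Finset.range (d + 1), a j * (weightPoly k * C u + digitPoly k * C 1) ^ j *
      (digitPoly k * C u) ^ (d - j)).natDegree ≤ n + d * (k - 1) := by
    refine natDegree_sum_le_of_forall_le _ _ fun j hj => ?_
    have hjd : j + (d - j) = d := by have := Finset.mem_range.1 hj; omega
    have hA : (weightPoly k * C u + digitPoly k * C 1).natDegree ≤ k - 1 :=
      natDegree_add_le_of_degree_le
        ((natDegree_mul_C_le _ _).trans (natDegree_weightPoly_le k))
        ((natDegree_mul_C_le _ _).trans (natDegree_digitPoly hk0).le)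
    have hB : (digitPoly k * C u).natDegree ≤ k - 1 :=
      (natDegree_mul_C_le _ _).trans (natDegree_digitPoly hk0).le
    calc _ ≤ (n + j * (k - 1)) + (d - j) * (k - 1) :=
          natDegree_mul_le_of_le (natDegree_mul_le_of_le (hle j hj) (natDegree_pow_le_of_le _ hA))
            (natDegree_pow_le_of_le _ hB)
      _ = n + (j + (d - j)) * (k - 1) := by ring
      _ = n + d * (k - 1) := by rw [hjd]
  rw [h u 1, hR, hRdeg] at hLdeg
  have : f.natDegree * 1 ≤ f.natDegree * k := Nat.mul_le_mul_left _ (by omega)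
  omega

/-- There is no nonzero binary form of positive degree over `ℂ[z]` whose pullback under `A(z)` is a
multiple of its pullback under `z ↦ z ^ k`. Powers of `z - 1` are divided out until the form is
nonzero at `z = 1`. -/
theorem no_semiinvariant_form {k : ℕ} (hk : 2 ≤ k) {d : ℕ} (hd : 1 ≤ d)
    {a : ℕ → ℂ[X]} (ha : ∃ j ≤ d, a j ≠ 0) {c : ℂ[X]}
    (h : ∀ u v : ℂ, ∑ j ∈ Finset.range (d + 1), a j *
        (weightPoly k * C u + digitPoly k * C v) ^ j * (digitPoly k * C u) ^ (d - j) =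
      c * ∑ j ∈ Finset.range (d + 1), expand ℂ k (a j) * C (u ^ j * v ^ (d - j))) : False := by
  obtain ⟨j₀, hj₀, ha0⟩ := ha
  induction hN : (a j₀).natDegree using Nat.strong_induction_on generalizing a c with
  | _ N ih =>
  by_cases h1 : ∃ j ≤ d, (a j).eval 1 ≠ 0
  · exact no_semiinvariant_form_of_eval_one hk hd h1 h
  push Not at h1
  have hdiv : ∀ j ≤ d, (X - C 1) * (a j /ₘ (X - C 1)) = a j := fun j hj =>
    mul_divByMonic_eq_iff_isRoot.2 (h1 j hj)
  have hj := hdiv j₀ hj₀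
  have hb0 : a j₀ /ₘ (X - C 1) ≠ 0 := by
    intro h0; rw [h0, mul_zero] at hj; exact ha0 hj.symm
  refine ih _ ?_ (a := fun j => a j /ₘ (X - C 1)) (c := c * digitPoly k) ?_ hb0 rfl
  · rw [← hN]
    nth_rewrite 2 [← hj]
    rw [natDegree_mul (X_sub_C_ne_zero 1) hb0, natDegree_X_sub_C]
    omega
  · intro u v
    refine mul_left_cancel₀ (X_sub_C_ne_zero (1 : ℂ)) ?_
    have h2 : expand ℂ k (X - C 1) = digitPoly k * (X - C 1) := by
      rw [digitPoly_mul]; simp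
    have h3 := h u v
    calc _ = ∑ j ∈ Finset.range (d + 1), a j *
        (weightPoly k * C u + digitPoly k * C v) ^ j * (digitPoly k * C u) ^ (d - j) := by
          rw [Finset.mul_sum]
          refine Finset.sum_congr rfl fun j hj => ?_
          nth_rewrite 2 [← hdiv j (by have := Finset.mem_range.1 hj; omega)]
          ring
      _ = _ := by
          rw [h3, Finset.mul_sum, Finset.mul_sum, Finset.mul_sum]
          refine Finset.sum_congr rfl fun j hj => ?_
          rw [← hdiv j (by have := Finset.mem_range.1 hj; omega), map_mul, h2]
          simp only [hdiv j (by have := Finset.mem_range.1 hj; omega)]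
          ring

/-! ### The sequence `κ` -/

/-- The second coordinate of the vector `A_{i₀} ⋯ A_{i_s} [1 0]ᵀ` whose first coordinate is
`κ(n)`. It vanishes at `n = 0`, where the product is empty. -/
def kappaSnd (k n : ℕ) : ℤ := if n = 0 then 0 else kappa k (n / k)

/-- The second row of `A_i` is `(1, 0)`, so the second coordinate is `κ` of the number formed by the
remaining digits. -/
theorem prod_digits_mulVec {k : ℕ} (hk : 2 ≤ k) (n : ℕ) :
    ((Nat.digits k n).map zarembaMatrix).prod *ᵥ ![1, 0] = ![kappa k n, kappaSnd k n] := by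
  ext i
  fin_cases i
  · simp [kappa, dotProduct, Fin.sum_univ_two]
  · by_cases hn : n = 0
    · simp [hn, kappaSnd]
    · rw [Nat.digits_def' hk (Nat.pos_of_ne_zero hn), List.map_cons, List.prod_cons,
        ← mulVec_mulVec]
      simp [kappaSnd, hn, kappa, zarembaMatrix, mulVec, dotProduct, Fin.sum_univ_two]

theorem kappa_mul_add {k : ℕ} (hk : 2 ≤ k) (n : ℕ) {i : ℕ} (hi : i < k) :
    kappa k (k * n + i) = (i + 1) * kappa k n + kappaSnd k n := by
  by_cases h : i = 0 ∧ n = 0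
  · simp [h.1, h.2, kappa, kappaSnd, dotProduct, Fin.sum_univ_two]
  · have hd : Nat.digits k (k * n + i) = i :: Nat.digits k n := by
      rw [add_comm]
      exact Nat.digits_add k (by omega) i n hi (by tauto)
    unfold kappa
    rw [hd, List.map_cons, List.prod_cons, ← mulVec_mulVec, prod_digits_mulVec hk]
    simp [zarembaMatrix, mulVec, dotProduct, Fin.sum_univ_two, kappa]

theorem kappa_zero (k : ℕ) : kappa k 0 = 1 := by
  simp [kappa, dotProduct, Fin.sum_univ_two]

theorem one_le_kappa {k : ℕ} (hk : 2 ≤ k) (n : ℕ) : 1 ≤ kappa k n := by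
  induction n using Nat.strong_induction_on with
  | _ n ih =>
  by_cases hn : n = 0
  · rw [hn, kappa_zero]
  · have hlt : n / k < n := Nat.div_lt_self (by omega) hk
    have h1 := ih _ hlt
    rw [← Nat.div_add_mod n k, kappa_mul_add hk _ (Nat.mod_lt _ (by omega))]
    have h2 : 0 ≤ kappaSnd k (n / k) := by
      unfold kappaSnd
      split_ifs with h0
      · exact le_rfl
      · have := ih (n / k / k) (lt_of_le_of_lt (Nat.div_le_self _ _) hlt)
        omega
    have h3 : (0 : ℤ) ≤ ((n % k : ℕ) : ℤ) := by positivity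
    nlinarith

theorem kappaSnd_le_kappa {k : ℕ} (hk : 2 ≤ k) (n : ℕ) : kappaSnd k n ≤ kappa k n := by
  by_cases hn : n = 0
  · rw [hn, kappa_zero]; simp [kappaSnd]
  · rw [kappaSnd, if_neg hn]
    conv_rhs => rw [← Nat.div_add_mod n k, kappa_mul_add hk _ (Nat.mod_lt _ (by omega))]
    have h1 := one_le_kappa hk (n / k)
    have h2 : 0 ≤ kappaSnd k (n / k) := by
      unfold kappaSnd
      split_ifs with h0
      · exact le_rfl
      · have := one_le_kappa hk (n / k / k)
        omega
    have h3 : (0 : ℤ) ≤ ((n % k : ℕ) : ℤ) := by positivity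
    nlinarith

theorem kappa_le {k : ℕ} (hk : 2 ≤ k) (n : ℕ) : kappa k n ≤ ((n : ℤ) + 1) ^ 3 := by
  induction n using Nat.strong_induction_on with
  | _ n ih =>
  by_cases hn : n = 0
  · rw [hn, kappa_zero]; simp
  · have h1 := ih _ (Nat.div_lt_self (by omega : 0 < n) hk)
    have hi := Nat.mod_lt n (by omega : 0 < k)
    have h2 : kappaSnd k (n / k) ≤ kappa k (n / k) := kappaSnd_le_kappa hk _
    have hnm : (n : ℤ) = k * (n / k : ℕ) + (n % k : ℕ) := by
      exact_mod_cast (Nat.div_add_mod n k).symm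
    have hκ : kappa k n = (((n % k : ℕ) : ℤ) + 1) * kappa k (n / k) + kappaSnd k (n / k) := by
      conv_lhs => rw [← Nat.div_add_mod n k, kappa_mul_add hk _ hi]
    rw [hκ, hnm]
    have hpos := one_le_kappa hk (n / k)
    have hs0 : n / k = 0 → kappaSnd k (n / k) = 0 := fun h => by simp [kappaSnd, h]
    have hk' : (2 : ℤ) ≤ k := by exact_mod_cast hk
    have hi' : ((n % k : ℕ) : ℤ) + 1 ≤ k := by exact_mod_cast hi
    have hi0 : (0 : ℤ) ≤ ((n % k : ℕ) : ℤ) := by positivity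
    have hm0 : (0 : ℤ) ≤ ((n / k : ℕ) : ℤ) := by positivity
    rcases Nat.eq_zero_or_pos (n / k) with h0 | h0
    · rw [hs0 h0, h0, kappa_zero]
      generalize ((n % k : ℕ) : ℤ) = i at *
      have : i + 1 ≤ (i + 1) ^ 3 := le_self_pow₀ (by omega) (by norm_num)
      simpa using this
    · have hm1 : (1 : ℤ) ≤ ((n / k : ℕ) : ℤ) := by exact_mod_cast h0
      generalize ((n % k : ℕ) : ℤ) = i at *
      generalize ((n / k : ℕ) : ℤ) = m at *
      generalize kappa k (n / k) = x at *
      generalize kappaSnd k (n / k) = y at *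
      -- `(i + 2) x ≤ (k + 1) (m + 1) ^ 3 ≤ (k m + 1) ^ 3`, as `k + 1 ≤ ((k + 1) / 2) ^ 3`
      have ha : (i + 1) * x + y ≤ (k + 1) * (m + 1) ^ 3 := by
        nlinarith [pow_pos (by omega : 0 < m + 1) 3]
      have hb : ((k : ℤ) + 1) * (m + 1) ≤ 2 * (k * m + 1) := by nlinarith
      have hc : (((k : ℤ) + 1) * (m + 1)) ^ 3 ≤ (2 * (k * m + 1)) ^ 3 :=
        pow_le_pow_left₀ (by positivity) hb 3
      have hd : 8 * ((k : ℤ) + 1) ≤ ((k : ℤ) + 1) ^ 3 := by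
        have : (8 : ℤ) ≤ (k + 1) ^ 2 := by nlinarith
        nlinarith
      have he : 8 * ((k + 1) * (m + 1) ^ 3) ≤ 8 * (k * m + 1) ^ 3 := by
        calc 8 * (((k : ℤ) + 1) * (m + 1) ^ 3) = (8 * (k + 1)) * (m + 1) ^ 3 := by ring
          _ ≤ (k + 1) ^ 3 * (m + 1) ^ 3 := mul_le_mul_of_nonneg_right hd (by positivity)
          _ = ((k + 1) * (m + 1)) ^ 3 := by ring
          _ ≤ _ := hc
          _ = _ := by ring
      have hf : (k * m + 1) ^ 3 ≤ (k * m + i + 1 : ℤ) ^ 3 :=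
        pow_le_pow_left₀ (by positivity) (by omega) 3
      omega

/-! ### The Mahler system on the unit disc -/

theorem summable_norm_mul_pow {a : ℕ → ℂ} (ha : ∀ n, ‖a n‖ ≤ ((n : ℝ) + 1) ^ 3) {r : ℝ}
    (hr0 : 0 ≤ r) (hr : r < 1) : Summable fun n : ℕ => ‖a n‖ * r ^ n := by
  have h := (summable_nat_add_iff 1).2
    (summable_pow_mul_geometric_of_norm_lt_one (R := ℝ) 3 (r := r)
      (by rwa [Real.norm_of_nonneg hr0]))
  rcases hr0.eq_or_lt with h0 | h0
  · refine summable_of_ne_finset_zero (s := {0}) fun n hn => ?_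
    rw [← h0, zero_pow (by simpa using hn), mul_zero]
  · refine Summable.of_nonneg_of_le (fun n => by positivity) (fun n => ?_) (h.mul_left r⁻¹)
    calc ‖a n‖ * r ^ n ≤ ((n : ℝ) + 1) ^ 3 * r ^ n := by gcongr; exact ha n
      _ = _ := by push_cast; field_simp; ring

theorem summable_mul_pow {a : ℕ → ℂ} (ha : ∀ n, ‖a n‖ ≤ ((n : ℝ) + 1) ^ 3) {z : ℂ}
    (hz : ‖z‖ < 1) : Summable fun n : ℕ => a n * z ^ n := by
  refine Summable.of_norm ?_
  simpa using summable_norm_mul_pow ha (norm_nonneg z) hz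

theorem norm_kappa_le {k : ℕ} (hk : 2 ≤ k) (n : ℕ) : ‖(kappa k n : ℂ)‖ ≤ ((n : ℝ) + 1) ^ 3 := by
  rw [Complex.norm_intCast,
    abs_of_nonneg (by exact_mod_cast (one_le_kappa hk n).trans' zero_le_one)]
  exact_mod_cast kappa_le hk n

theorem norm_kappa_div_le {k : ℕ} (hk : 2 ≤ k) (n : ℕ) :
    ‖(kappa k (n / k) : ℂ)‖ ≤ ((n : ℝ) + 1) ^ 3 :=
  (norm_kappa_le hk _).trans (by gcongr; exact Nat.div_le_self _ _)

theorem tsum_eq_tsum_sum_range {k : ℕ} (hk : k ≠ 0) {f : ℕ → ℂ} (hf : Summable f) :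
    ∑' n, f n = ∑' n, ∑ i ∈ Finset.range k, f (k * n + i) := by
  have : NeZero k := ⟨hk⟩
  have hs : Summable fun p : ℕ × Fin k => f ((Nat.divModEquiv k).symm p) :=
    (Nat.divModEquiv k).symm.summable_iff.2 hf
  rw [← (Nat.divModEquiv k).symm.tsum_eq f, hs.tsum_prod]
  refine tsum_congr fun n => ?_
  rw [tsum_fintype, Finset.sum_range]
  simp [mul_comm]

/-- The generating function `M(z) = Q(z) K(z ^ k) - 1` of `kappaSnd`. -/
noncomputable def zarembaM (k : ℕ) (z : ℂ) : ℂ :=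
  (digitPoly k).eval z * zarembaK k (z ^ k) - 1

theorem norm_pow_lt_one {k : ℕ} (hk : k ≠ 0) {z : ℂ} (hz : ‖z‖ < 1) : ‖z ^ k‖ < 1 := by
  rw [norm_pow]; exact pow_lt_one₀ (norm_nonneg z) hz hk

theorem tsum_kappa_div {k : ℕ} (hk : 2 ≤ k) {z : ℂ} (hz : ‖z‖ < 1) :
    ∑' n, (kappa k (n / k) : ℂ) * z ^ n = (digitPoly k).eval z * zarembaK k (z ^ k) := by
  rw [tsum_eq_tsum_sum_range (by omega : k ≠ 0) (summable_mul_pow (norm_kappa_div_le hk) hz),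
    zarembaK, ← tsum_mul_left]
  refine tsum_congr fun n => ?_
  rw [digitPoly, eval_finsetSum, Finset.sum_mul]
  refine Finset.sum_congr rfl fun i hi => ?_
  have hi := Finset.mem_range.1 hi
  rw [Nat.mul_add_div (by omega), Nat.div_eq_of_lt hi, add_zero, eval_pow, eval_X, pow_add, pow_mul]
  ring

theorem kappaSnd_eq (k n : ℕ) :
    (kappaSnd k n : ℂ) = kappa k (n / k) - if n = 0 then 1 else 0 := by
  by_cases hn : n = 0
  · simp [hn, kappaSnd, kappa_zero]
  · simp [hn, kappaSnd]

theorem hasSum_kappaSnd {k : ℕ} (hk : 2 ≤ k) {z : ℂ} (hz : ‖z‖ < 1) :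
    HasSum (fun n => (kappaSnd k n : ℂ) * z ^ n) (zarembaM k z) := by
  have h1 := (summable_mul_pow (norm_kappa_div_le hk) hz).hasSum
  rw [tsum_kappa_div hk hz] at h1
  have h2 : HasSum (fun n : ℕ => (if n = 0 then (1 : ℂ) else 0)) 1 := hasSum_ite_eq 0 1
  refine (h1.sub h2).congr_fun fun n => ?_
  rw [kappaSnd_eq, sub_mul]
  congr 1
  by_cases hn : n = 0 <;> simp [hn]

theorem zarembaK_functional_equation {k : ℕ} (hk : 2 ≤ k) {z : ℂ} (hz : ‖z‖ < 1) :
    zarembaK k z = (weightPoly k).eval z * zarembaK k (z ^ k) +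
      (digitPoly k).eval z * zarembaM k (z ^ k) := by
  have hw := norm_pow_lt_one (by omega : k ≠ 0) hz
  have h0 : HasSum (fun n => (kappa k n : ℂ) * (z ^ k) ^ n) (zarembaK k (z ^ k)) :=
    (summable_mul_pow (norm_kappa_le hk) hw).hasSum
  have h1 := h0.mul_left ((weightPoly k).eval z)
  have h2 := (hasSum_kappaSnd hk hw).mul_left ((digitPoly k).eval z)
  have h3 : zarembaK k z = ∑' n : ℕ, (kappa k n : ℂ) * z ^ n := rfl
  rw [h3, tsum_eq_tsum_sum_range (by omega : k ≠ 0) (summable_mul_pow (norm_kappa_le hk) hz),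
    ← (h1.add h2).tsum_eq]
  refine tsum_congr fun n => ?_
  rw [digitPoly, weightPoly, eval_finsetSum, eval_finsetSum, Finset.sum_mul, Finset.sum_mul,
    ← Finset.sum_add_distrib]
  refine Finset.sum_congr rfl fun i hi => ?_
  rw [kappa_mul_add hk n (Finset.mem_range.1 hi)]
  simp only [eval_mul, eval_C, eval_pow, eval_X, pow_add, pow_mul]
  push_cast
  ring

theorem differentiableOn_zarembaK {k : ℕ} (hk : 2 ≤ k) :
    DifferentiableOn ℂ (zarembaK k) (Metric.ball 0 1) := by
  intro z hz
  have hz1 : ‖z‖ < 1 := by simpa using hz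
  obtain ⟨r, hzr, hr1⟩ := exists_between hz1
  have hr0 : 0 ≤ r := (norm_nonneg z).trans hzr.le
  have h : DifferentiableOn ℂ (zarembaK k) (Metric.ball 0 r) := by
    refine Complex.differentiableOn_tsum_of_summable_norm
      (summable_norm_mul_pow (norm_kappa_le hk) hr0 hr1) (fun n => by fun_prop) Metric.isOpen_ball
      fun n w hw => ?_
    have hw : ‖w‖ < r := by simpa using hw
    rw [norm_mul, norm_pow]
    gcongr
  have hnhds : Metric.ball (0 : ℂ) r ∈ nhds z := Metric.isOpen_ball.mem_nhds (by simpa using hzr)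
  exact (h.differentiableAt hnhds).differentiableWithinAt

theorem analyticOnNhd_zarembaK {k : ℕ} (hk : 2 ≤ k) :
    AnalyticOnNhd ℂ (zarembaK k) (Metric.ball 0 1) :=
  (differentiableOn_zarembaK hk).analyticOnNhd Metric.isOpen_ball

theorem analyticOnNhd_zarembaM {k : ℕ} (hk : 2 ≤ k) :
    AnalyticOnNhd ℂ (zarembaM k) (Metric.ball 0 1) := by
  refine DifferentiableOn.analyticOnNhd ?_ Metric.isOpen_ball
  have h : DifferentiableOn ℂ (fun z => zarembaK k (z ^ k)) (Metric.ball 0 1) :=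
    (differentiableOn_zarembaK hk).comp (t := Metric.ball 0 1) (f := fun z : ℂ => z ^ k)
      (by fun_prop) fun z hz => by
        simpa using norm_pow_lt_one (by omega : k ≠ 0) (by simpa using hz : ‖z‖ < 1)
  exact ((digitPoly k).differentiable.differentiableOn.mul h).sub (differentiableOn_const 1)

/-! ### Radial growth and transcendence of `K` -/

theorem zarembaK_ofReal (k : ℕ) (t : ℝ) :
    zarembaK k t = ((∑' n : ℕ, (kappa k n : ℝ) * t ^ n : ℝ) : ℂ) := by
  rw [zarembaK, Complex.ofReal_tsum]
  push_cast
  rfl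

theorem summable_kappa_real {k : ℕ} (hk : 2 ≤ k) {t : ℝ} (h0 : 0 ≤ t) (h1 : t < 1) :
    Summable fun n : ℕ => (kappa k n : ℝ) * t ^ n := by
  refine (summable_norm_mul_pow (norm_kappa_le hk) h0 h1).congr fun n => ?_
  rw [Complex.norm_intCast,
    abs_of_nonneg (by exact_mod_cast (one_le_kappa hk n).trans' zero_le_one)]

theorem norm_zarembaK_ofReal {k : ℕ} (hk : 2 ≤ k) {t : ℝ} (h0 : 0 ≤ t) :
    ‖zarembaK k t‖ = ∑' n : ℕ, (kappa k n : ℝ) * t ^ n := by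
  rw [zarembaK_ofReal, Complex.norm_real, Real.norm_of_nonneg]
  refine tsum_nonneg fun n => mul_nonneg ?_ (by positivity)
  exact_mod_cast (one_le_kappa hk n).trans' zero_le_one

theorem inv_one_sub_le_norm_zarembaK {k : ℕ} (hk : 2 ≤ k) {t : ℝ} (h0 : 0 ≤ t) (h1 : t < 1) :
    (1 - t)⁻¹ ≤ ‖zarembaK k t‖ := by
  rw [norm_zarembaK_ofReal hk h0, ← tsum_geometric_of_lt_one h0 h1]
  refine (summable_geometric_of_lt_one h0 h1).tsum_le_tsum (fun n => ?_)
    (summable_kappa_real hk h0 h1)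
  exact le_mul_of_one_le_left (by positivity) (by exact_mod_cast one_le_kappa hk n)

theorem norm_zarembaM_le {k : ℕ} (hk : 2 ≤ k) {t : ℝ} (h0 : 0 ≤ t) (h1 : t < 1) :
    ‖zarembaM k t‖ ≤ ‖zarembaK k t‖ := by
  have ht : ‖(t : ℂ)‖ < 1 := by rwa [Complex.norm_real, Real.norm_of_nonneg h0]
  rw [norm_zarembaK_ofReal hk h0, ← (hasSum_kappaSnd hk ht).tsum_eq]
  refine tsum_of_norm_bounded (summable_kappa_real hk h0 h1).hasSum fun n => ?_
  have hs : 0 ≤ kappaSnd k n := by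
    unfold kappaSnd
    split_ifs with h
    · exact le_rfl
    · exact (one_le_kappa hk _).trans' zero_le_one
  rw [norm_mul, norm_pow, Complex.norm_real, Real.norm_of_nonneg h0, Complex.norm_intCast,
    abs_of_nonneg (by exact_mod_cast hs)]
  gcongr
  exact_mod_cast kappaSnd_le_kappa hk n

theorem tendsto_norm_zarembaK {k : ℕ} (hk : 2 ≤ k) :
    Tendsto (fun t : ℝ => ‖zarembaK k t‖) (𝓝[<] 1) atTop := by
  have h : Tendsto (fun t : ℝ => (1 - t)⁻¹) (𝓝[<] 1) atTop := by
    refine tendsto_inv_nhdsGT_zero.comp (tendsto_nhdsWithin_iff.2 ⟨?_, ?_⟩)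
    · have : Tendsto (fun t : ℝ => 1 - t) (𝓝 1) (𝓝 (1 - 1)) := by
        exact (continuous_const.sub continuous_id).tendsto 1
      rw [sub_self] at this
      exact this.mono_left nhdsWithin_le_nhds
    · filter_upwards [self_mem_nhdsWithin] with t ht
      exact sub_pos.2 (Set.mem_Iio.1 ht)
  refine tendsto_atTop_mono' _ ?_ h
  filter_upwards [Ioo_mem_nhdsLT (zero_lt_one (α := ℝ))] with t ht
  exact inv_one_sub_le_norm_zarembaK hk ht.1.le ht.2

theorem tendsto_pow_nhdsLT_one {k : ℕ} (hk : k ≠ 0) :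
    Tendsto (fun t : ℝ => t ^ k) (𝓝[<] 1) (𝓝[<] 1) := by
  refine tendsto_nhdsWithin_iff.2 ⟨?_, ?_⟩
  · have : Tendsto (fun t : ℝ => t ^ k) (𝓝 1) (𝓝 (1 ^ k)) := (continuous_pow k).tendsto 1
    rw [one_pow] at this
    exact this.mono_left nhdsWithin_le_nhds
  · filter_upwards [Ioo_mem_nhdsLT (zero_lt_one (α := ℝ))] with t ht
    exact pow_lt_one₀ ht.1.le ht.2 hk

theorem tendsto_radial {g : ℂ → ℝ} (hg : Continuous g) (ξ : ℂ) :
    Tendsto (fun t : ℝ => g (t * ξ)) (𝓝[<] 1) (𝓝 (g ξ)) := by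
  have h : Continuous fun t : ℝ => g (t * ξ) := by fun_prop
  have := h.tendsto 1
  rw [Complex.ofReal_one, one_mul] at this
  exact this.mono_left nhdsWithin_le_nhds

/-- The vector `(K, M)` is radially unbounded at every nontrivial `k`-th root of unity, where the
image of `A(z)` degenerates to the line of `K`. -/
theorem tendsto_radial_atTop_of_pow_eq_one {k : ℕ} (hk : 2 ≤ k) {ζ : ℂ} (hζ : ζ ^ k = 1)
    (h1 : ζ ≠ 1) :
    Tendsto (fun t : ℝ => ‖zarembaK k (t * ζ)‖ + ‖zarembaM k (t * ζ)‖) (𝓝[<] 1) atTop := by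
  have hk0 : k ≠ 0 := by omega
  have hnorm : ‖ζ‖ = 1 := Complex.norm_eq_one_of_pow_eq_one hζ hk0
  have hlim : Tendsto (fun t : ℝ => ‖(weightPoly k).eval (t * ζ)‖ - ‖(digitPoly k).eval (t * ζ)‖)
      (𝓝[<] 1) (𝓝 ‖(weightPoly k).eval ζ‖) := by
    have := tendsto_radial (g := fun z => ‖(weightPoly k).eval z‖ - ‖(digitPoly k).eval z‖)
      (by fun_prop) ζ
    simpa [eval_digitPoly_eq_zero hζ h1] using this
  have hpos : 0 < ‖(weightPoly k).eval ζ‖ := norm_pos_iff.2 (eval_weightPoly_ne_zero hk0 hζ h1)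
  refine tendsto_atTop_mono' _ ?_ (hlim.pos_mul_atTop hpos
    ((tendsto_norm_zarembaK hk).comp (tendsto_pow_nhdsLT_one hk0)))
  filter_upwards [Ioo_mem_nhdsLT (zero_lt_one (α := ℝ))] with t ht
  have hz : ‖(t : ℂ) * ζ‖ < 1 := by
    rw [norm_mul, hnorm, mul_one, Complex.norm_real, Real.norm_of_nonneg ht.1.le]; exact ht.2
  have hzk : ((t : ℂ) * ζ) ^ k = ((t ^ k : ℝ) : ℂ) := by rw [mul_pow, hζ]; push_cast; ring
  have hM := norm_zarembaM_le hk (pow_nonneg ht.1.le k) (pow_lt_one₀ ht.1.le ht.2 hk0)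
  rw [zarembaK_functional_equation hk hz, hzk]
  have h2 := norm_sub_le_norm_add ((weightPoly k).eval (t * ζ) * zarembaK k (t ^ k : ℝ))
    ((digitPoly k).eval (t * ζ) * zarembaM k (t ^ k : ℝ))
  rw [norm_mul, norm_mul] at h2
  have h3 : ‖(digitPoly k).eval (t * ζ)‖ * ‖zarembaM k (t ^ k : ℝ)‖ ≤
      ‖(digitPoly k).eval (t * ζ)‖ * ‖zarembaK k (t ^ k : ℝ)‖ :=
    mul_le_mul_of_nonneg_left hM (norm_nonneg _)
  have h4 := norm_nonneg (zarembaM k (t * ζ))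
  simp only [Function.comp_apply]
  linarith

/-- Radial unboundedness of `(K, M)` at `ξ ^ k` is inherited by `ξ` when `A(ξ)` is invertible. -/
theorem tendsto_radial_atTop_of_pow {k : ℕ} (hk : 2 ≤ k) {ξ : ℂ} (hnorm : ‖ξ‖ = 1)
    (h1 : ξ ^ k ≠ 1)
    (h : Tendsto (fun t : ℝ => ‖zarembaK k (t * ξ ^ k)‖ + ‖zarembaM k (t * ξ ^ k)‖) (𝓝[<] 1)
      atTop) :
    Tendsto (fun t : ℝ => ‖zarembaK k (t * ξ)‖ + ‖zarembaM k (t * ξ)‖) (𝓝[<] 1) atTop := by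
  have hk0 : k ≠ 0 := by omega
  have hQ : 0 < ‖(digitPoly k).eval ξ‖ := norm_pos_iff.2 (eval_digitPoly_ne_zero h1)
  have hlim : Tendsto (fun t : ℝ => ‖(digitPoly k).eval (t * ξ)‖ ^ 2 *
      (2 * ‖(digitPoly k).eval (t * ξ)‖ + ‖(weightPoly k).eval (t * ξ)‖)⁻¹) (𝓝[<] 1)
      (𝓝 (‖(digitPoly k).eval ξ‖ ^ 2 *
        (2 * ‖(digitPoly k).eval ξ‖ + ‖(weightPoly k).eval ξ‖)⁻¹)) := by
    refine (tendsto_radial (g := fun z => ‖(digitPoly k).eval z‖ ^ 2) (by fun_prop) ξ).mul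
      (Tendsto.inv₀ (tendsto_radial (g := fun z => 2 * ‖(digitPoly k).eval z‖ +
        ‖(weightPoly k).eval z‖) (by fun_prop) ξ) ?_)
    positivity
  have hQev : ∀ᶠ t : ℝ in 𝓝[<] 1, 0 < ‖(digitPoly k).eval (t * ξ)‖ :=
    (tendsto_radial (g := fun z => ‖(digitPoly k).eval z‖) (by fun_prop) ξ).eventually
      (lt_mem_nhds hQ)
  have hmul := hlim.pos_mul_atTop (by positivity) (h.comp (tendsto_pow_nhdsLT_one hk0))
  refine tendsto_atTop_mono' _ ?_ (tendsto_atTop_add_const_right _ (-1) hmul)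
  filter_upwards [Ioo_mem_nhdsLT (zero_lt_one (α := ℝ)), hQev] with t ht hQt
  have hz : ‖(t : ℂ) * ξ‖ < 1 := by
    rw [norm_mul, hnorm, mul_one, Complex.norm_real, Real.norm_of_nonneg ht.1.le]; exact ht.2
  have hzk : ((t ^ k : ℝ) : ℂ) * ξ ^ k = ((t : ℂ) * ξ) ^ k := by rw [mul_pow]; push_cast; ring
  simp only [Function.comp_apply]
  rw [hzk]
  generalize (t : ℂ) * ξ = z at *
  have hK : (digitPoly k).eval z * zarembaK k (z ^ k) = zarembaM k z + 1 := by
    rw [zarembaM]; ring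
  have hM : (digitPoly k).eval z * zarembaM k (z ^ k) =
      zarembaK k z - (weightPoly k).eval z * zarembaK k (z ^ k) := by
    rw [zarembaK_functional_equation hk hz]; ring
  have hK' : ‖(digitPoly k).eval z‖ * ‖zarembaK k (z ^ k)‖ ≤ ‖zarembaM k z‖ + 1 := by
    rw [← norm_mul, hK]
    exact (norm_add_le _ _).trans (by simp)
  have hM' : ‖(digitPoly k).eval z‖ * ‖zarembaM k (z ^ k)‖ ≤
      ‖zarembaK k z‖ + ‖(weightPoly k).eval z‖ * ‖zarembaK k (z ^ k)‖ := by
    rw [← norm_mul, hM, ← norm_mul]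
    exact norm_sub_le _ _
  generalize ‖(digitPoly k).eval z‖ = q at *
  have hp := norm_nonneg ((weightPoly k).eval z)
  generalize ‖(weightPoly k).eval z‖ = p at *
  have hx := norm_nonneg (zarembaK k z)
  have hy := norm_nonneg (zarembaM k z)
  generalize ‖zarembaK k z‖ = x at *
  generalize ‖zarembaM k z‖ = y at *
  generalize ‖zarembaK k (z ^ k)‖ = x' at *
  generalize ‖zarembaM k (z ^ k)‖ = y' at *
  have hmain : q ^ 2 * (x' + y') ≤ (2 * q + p) * (x + y + 1) := by
    nlinarith [mul_le_mul_of_nonneg_left hK' hQt.le, mul_le_mul_of_nonneg_left hM' hQt.le,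
      mul_le_mul_of_nonneg_left hK' hp, mul_nonneg hp hx, mul_nonneg hQt.le hx,
      mul_nonneg hQt.le hy]
  have hpos : 0 < 2 * q + p := by positivity
  have : q ^ 2 * (2 * q + p)⁻¹ * (x' + y') ≤ x + y + 1 := by
    rw [mul_right_comm, ← div_eq_mul_inv, div_le_iff₀ hpos]
    linarith
  linarith

theorem exp_tower_pow {k : ℕ} (hk : k ≠ 0) (m : ℕ) :
    Complex.exp (2 * Real.pi * Complex.I / (k ^ (m + 1 + 1) : ℕ)) ^ k =
      Complex.exp (2 * Real.pi * Complex.I / (k ^ (m + 1) : ℕ)) := by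
  rw [← Complex.exp_nat_mul]
  congr 1
  have : (k : ℂ) ≠ 0 := by exact_mod_cast hk
  push_cast
  field_simp
  ring

theorem tendsto_radial_atTop_exp {k : ℕ} (hk : 2 ≤ k) (m : ℕ) :
    Tendsto (fun t : ℝ =>
      ‖zarembaK k (t * Complex.exp (2 * Real.pi * Complex.I / (k ^ (m + 1) : ℕ)))‖ +
      ‖zarembaM k (t * Complex.exp (2 * Real.pi * Complex.I / (k ^ (m + 1) : ℕ)))‖)
      (𝓝[<] 1) atTop := by
  have hk0 : k ≠ 0 := by omega
  have hprim : ∀ m : ℕ, IsPrimitiveRoot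
      (Complex.exp (2 * Real.pi * Complex.I / (k ^ (m + 1) : ℕ))) (k ^ (m + 1)) := fun m =>
    Complex.isPrimitiveRoot_exp _ (pow_ne_zero _ hk0)
  have hne : ∀ m : ℕ, Complex.exp (2 * Real.pi * Complex.I / (k ^ (m + 1) : ℕ)) ≠ 1 := fun m =>
    (hprim m).ne_one (Nat.one_lt_pow (by omega) (by omega))
  induction m with
  | zero =>
    refine tendsto_radial_atTop_of_pow_eq_one hk ?_ (hne 0)
    simpa using (hprim 0).pow_eq_one
  | succ m ih =>
    refine tendsto_radial_atTop_of_pow hk ((hprim (m + 1)).norm'_eq_one (pow_ne_zero _ hk0)) ?_ ?_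
    · rw [exp_tower_pow hk0]; exact hne m
    · rw [exp_tower_pow hk0]; exact ih

/-- A bound for the roots of a polynomial that stays meaningful where its leading coefficient is
small. -/
theorem norm_leading_mul_root_le (a : ℕ → ℂ) (n : ℕ) {x : ℂ}
    (h : ∑ i ∈ Finset.range (n + 1), a i * x ^ i = 0) :
    ‖a n‖ * ‖x‖ ≤ ‖a n‖ + ∑ i ∈ Finset.range n, ‖a i‖ := by
  have hS : 0 ≤ ∑ i ∈ Finset.range n, ‖a i‖ := Finset.sum_nonneg fun i _ => norm_nonneg _
  rcases le_or_gt ‖x‖ 1 with hx | hx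
  · have := mul_le_mul_of_nonneg_left hx (norm_nonneg (a n))
    linarith
  rw [Finset.sum_range_succ] at h
  cases n with
  | zero => simp at h; simp [h]
  | succ n =>
    have h1 : a (n + 1) * x ^ (n + 1) = -∑ i ∈ Finset.range (n + 1), a i * x ^ i := by
      linear_combination h
    have h2 : ‖a (n + 1)‖ * ‖x‖ ^ (n + 1) ≤ (∑ i ∈ Finset.range (n + 1), ‖a i‖) * ‖x‖ ^ n := by
      rw [← norm_pow, ← norm_mul, h1, norm_neg, Finset.sum_mul]
      refine norm_sum_le_of_le _ fun i hi => ?_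
      rw [norm_mul, norm_pow]
      gcongr
      · exact hx.le
      · have := Finset.mem_range.1 hi; omega
    rw [pow_succ', ← mul_assoc] at h2
    have := le_of_mul_le_mul_right h2 (by positivity)
    linarith [norm_nonneg (a (n + 1))]

/-- `K` is transcendental over `ℂ(z)`: the leading coefficient `a` of an algebraic relation would
satisfy `a(ξ) a(ξ ^ k) = 0` at each of the infinitely many points `ξ` where `(K, M)` is radially
unbounded. -/
theorem zarembaK_transcendental {k : ℕ} (hk : 2 ≤ k) {r : ℂ[X][X]} (hr : r ≠ 0)
    (h : ∀ z : ℂ, ‖z‖ < 1 → r.eval₂ (evalRingHom z) (zarembaK k z) = 0) : False := by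
  have hk0 : k ≠ 0 := by omega
  set a := r.leadingCoeff with ha
  have ha0 : a * expand ℂ k a ≠ 0 :=
    mul_ne_zero (leadingCoeff_ne_zero.2 hr)
      ((expand_ne_zero (by omega)).2 (leadingCoeff_ne_zero.2 hr))
  set B : ℂ → ℝ := fun z => ‖a.eval z‖ + ∑ i ∈ Finset.range r.natDegree, ‖(r.coeff i).eval z‖
    with hB
  have hBc : Continuous B := by fun_prop
  have hroot : ∀ z : ℂ, ‖z‖ < 1 → ‖a.eval z‖ * ‖zarembaK k z‖ ≤ B z := by
    intro z hz
    have h1 := h z hz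
    rw [eval₂_eq_sum_range] at h1
    exact norm_leading_mul_root_le (fun i => (r.coeff i).eval z) r.natDegree h1
  have hzero : ∀ m : ℕ, (a * expand ℂ k a).IsRoot
      (Complex.exp (2 * Real.pi * Complex.I / (k ^ (m + 1) : ℕ))) := by
    intro m
    have hnorm : ‖Complex.exp (2 * Real.pi * Complex.I / (k ^ (m + 1) : ℕ))‖ = 1 :=
      (Complex.isPrimitiveRoot_exp _ (pow_ne_zero _ hk0)).norm'_eq_one (pow_ne_zero _ hk0)
    have hT := tendsto_radial_atTop_exp hk m
    generalize Complex.exp (2 * Real.pi * Complex.I / (k ^ (m + 1) : ℕ)) = ξ at *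
    by_contra hne
    rw [IsRoot, eval_mul, expand_eval] at hne
    have hpos : 0 < ‖a.eval ξ‖ * ‖a.eval (ξ ^ k)‖ := by
      rw [← norm_mul]; exact norm_pos_iff.2 hne
    have hL := (tendsto_radial (g := fun z => ‖a.eval z‖ * ‖a.eval (z ^ k)‖) (by fun_prop)
      ξ).pos_mul_atTop hpos hT
    have hR := tendsto_radial (g := fun z => ‖a.eval (z ^ k)‖ * B z + ‖a.eval z‖ *
      (‖(digitPoly k).eval z‖ * B (z ^ k) + ‖a.eval (z ^ k)‖)) (by fun_prop) ξ
    refine not_tendsto_nhds_of_tendsto_atTop (tendsto_atTop_mono' _ ?_ hL) _ hR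
    filter_upwards [Ioo_mem_nhdsLT (zero_lt_one (α := ℝ))] with t ht
    have hz : ‖(t : ℂ) * ξ‖ < 1 := by
      rw [norm_mul, hnorm, mul_one, Complex.norm_real, Real.norm_of_nonneg ht.1.le]; exact ht.2
    generalize (t : ℂ) * ξ = z at *
    have h1 := hroot z hz
    have h2 := hroot (z ^ k) (norm_pow_lt_one hk0 hz)
    have h3 : ‖zarembaM k z‖ ≤ ‖(digitPoly k).eval z‖ * ‖zarembaK k (z ^ k)‖ + 1 := by
      rw [zarembaM, ← norm_mul]
      exact (norm_sub_le _ _).trans (by simp)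
    have h4 : ‖a.eval (z ^ k)‖ * ‖zarembaM k z‖ ≤
        ‖(digitPoly k).eval z‖ * B (z ^ k) + ‖a.eval (z ^ k)‖ := by
      calc _ ≤ ‖a.eval (z ^ k)‖ * (‖(digitPoly k).eval z‖ * ‖zarembaK k (z ^ k)‖ + 1) := by gcongr
        _ = ‖(digitPoly k).eval z‖ * (‖a.eval (z ^ k)‖ * ‖zarembaK k (z ^ k)‖) +
            ‖a.eval (z ^ k)‖ := by ring
        _ ≤ _ := by gcongr
    have h5 := mul_le_mul_of_nonneg_left h1 (norm_nonneg (a.eval (z ^ k)))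
    have h6 := mul_le_mul_of_nonneg_left h4 (norm_nonneg (a.eval z))
    linarith
  refine Set.infinite_of_injective_forall_mem (f := fun m : ℕ =>
    Complex.exp (2 * Real.pi * Complex.I / (k ^ (m + 1) : ℕ)))
    (s := {x | (a * expand ℂ k a).IsRoot x}) ?_ hzero ?_
  · intro m n hmn
    have h1 := Complex.isPrimitiveRoot_exp (k ^ (m + 1)) (pow_ne_zero _ hk0)
    have h2 := Complex.isPrimitiveRoot_exp (k ^ (n + 1)) (pow_ne_zero _ hk0)
    simp only at hmn
    rw [hmn] at h1
    have := Nat.pow_right_injective hk (h1.unique h2)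
    omega
  · exact finite_setOfPred_isRoot ha0

/-! ### The ideal of algebraic relations -/

/-- Gauss's lemma and the Bézout identity over the fraction field: a polynomial outside the ideal
of an irreducible `p` allows the variable to be eliminated. -/
theorem exists_bezout_eq_C {D : Type*} [CommRing D] [IsDomain D] [UniqueFactorizationMonoid D]
    {p q : D[X]} (hp : Irreducible p) (hdeg : p.natDegree ≠ 0) (hpq : ¬p ∣ q) :
    ∃ (u v : D[X]) (r : D), r ≠ 0 ∧ u * p + v * q = C r := by
  let F := FractionRing D
  have hprim : p.IsPrimitive := hp.isPrimitive hdeg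
  have hirr : Irreducible (p.map (algebraMap D F)) :=
    hprim.irreducible_iff_irreducible_map_fraction_map.1 hp
  have hndvd : ¬p.map (algebraMap D F) ∣ q.map (algebraMap D F) := fun h =>
    hpq (hprim.dvd_of_fraction_map_dvd_fraction_map h)
  obtain ⟨U, V, hUV⟩ := (hirr.coprime_iff_not_dvd).2 hndvd
  obtain ⟨b₁, hb₁, h₁⟩ := IsLocalization.integerNormalization_spec (nonZeroDivisors D) U
  obtain ⟨b₂, hb₂, h₂⟩ := IsLocalization.integerNormalization_spec (nonZeroDivisors D) V
  refine ⟨C b₂ * IsLocalization.integerNormalization (nonZeroDivisors D) U,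
    C b₁ * IsLocalization.integerNormalization (nonZeroDivisors D) V, b₁ * b₂,
    mul_ne_zero (nonZeroDivisors.ne_zero hb₁) (nonZeroDivisors.ne_zero hb₂), ?_⟩
  refine Polynomial.map_injective (algebraMap D F) (IsFractionRing.injective D F) ?_
  rw [Algebra.smul_def, Polynomial.algebraMap_apply] at h₁ h₂
  simp only [Polynomial.map_add, Polynomial.map_mul, map_C, h₁, h₂, map_mul]
  linear_combination (C (algebraMap D F b₁) * C (algebraMap D F b₂)) * hUV

/-- The values `(M(z), K(z))` of the two variables. -/
noncomputable def zarembaPair (k : ℕ) (z : ℂ) : Fin 2 → ℂ := ![zarembaM k z, zarembaK k z]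

/-- Evaluation of a polynomial over `ℂ[z]` at a point `z` and at values `w` of its variables. -/
noncomputable def evalAt (z : ℂ) (w : Fin 2 → ℂ) : MvPolynomial (Fin 2) ℂ[X] →+* ℂ :=
  MvPolynomial.eval₂Hom (evalRingHom z) w

@[simp]
theorem evalAt_C (z : ℂ) (w : Fin 2 → ℂ) (f : ℂ[X]) : evalAt z w (MvPolynomial.C f) = f.eval z := by
  simp [evalAt]

@[simp]
theorem evalAt_X (z : ℂ) (w : Fin 2 → ℂ) (i : Fin 2) : evalAt z w (MvPolynomial.X i) = w i := by
  simp [evalAt]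

/-- The ideal of algebraic relations over `ℂ[z]` between `M` and `K` on the unit disc. -/
noncomputable def relationIdeal (k : ℕ) : Ideal (MvPolynomial (Fin 2) ℂ[X]) :=
  RingHom.ker (RingHom.pi fun z : Metric.ball (0 : ℂ) 1 => evalAt (z : ℂ) (zarembaPair k z))

theorem mem_relationIdeal {k : ℕ} {p : MvPolynomial (Fin 2) ℂ[X]} :
    p ∈ relationIdeal k ↔ ∀ z : ℂ, ‖z‖ < 1 → evalAt z (zarembaPair k z) p = 0 := by
  rw [relationIdeal, RingHom.mem_ker, funext_iff]
  simp

theorem analyticOnNhd_evalAt {k : ℕ} (hk : 2 ≤ k) (p : MvPolynomial (Fin 2) ℂ[X]) :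
    AnalyticOnNhd ℂ (fun z => evalAt z (zarembaPair k z) p) (Metric.ball 0 1) := by
  induction p using MvPolynomial.induction_on with
  | C f =>
    simp only [evalAt_C]
    exact (f.differentiable.differentiableOn).analyticOnNhd Metric.isOpen_ball
  | add p q hp hq => simp only [map_add]; exact hp.add hq
  | mul_X p i hp =>
    simp only [map_mul, evalAt_X]
    refine hp.mul ?_
    fin_cases i
    · exact analyticOnNhd_zarembaM hk
    · exact analyticOnNhd_zarembaK hk

theorem relationIdeal_isPrime {k : ℕ} (hk : 2 ≤ k) : (relationIdeal k).IsPrime := by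
  refine ⟨fun h => ?_, fun {p q} hpq => ?_⟩
  · have h1 : (1 : MvPolynomial (Fin 2) ℂ[X]) ∈ relationIdeal k := by rw [h]; trivial
    have := mem_relationIdeal.1 h1 0 (by simp)
    simp at this
  · have h := AnalyticOnNhd.eq_zero_or_eq_zero_of_mul_eq_zero (analyticOnNhd_evalAt hk p)
      (analyticOnNhd_evalAt hk q) (fun z hz => by
        have := mem_relationIdeal.1 hpq z (by simpa using hz)
        rwa [map_mul] at this) (convex_ball 0 1).isPreconnected
    rw [mem_relationIdeal, mem_relationIdeal]
    simpa using h

theorem evalAt_eq_eval₂_finSuccEquiv (z : ℂ) (w : Fin 2 → ℂ) (p : MvPolynomial (Fin 2) ℂ[X]) :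
    evalAt z w p = (MvPolynomial.finSuccEquiv ℂ[X] 1 p).eval₂
      (MvPolynomial.eval₂Hom (evalRingHom z) fun _ => w 1) (w 0) := by
  have : evalAt z w = (Polynomial.eval₂RingHom
      (MvPolynomial.eval₂Hom (evalRingHom z) fun _ : Fin 1 => w 1) (w 0)).comp
      (MvPolynomial.finSuccEquiv ℂ[X] 1 : MvPolynomial (Fin 2) ℂ[X] →+* _) := by
    refine MvPolynomial.ringHom_ext (fun f => ?_) fun i => ?_
    · simp [MvPolynomial.finSuccEquiv_apply]
    · fin_cases i
      · simp [MvPolynomial.finSuccEquiv_X_zero]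
      · have := MvPolynomial.finSuccEquiv_X_succ (R := ℂ[X]) (n := 1) (j := 0)
        simp only [Fin.succ_zero_eq_one] at this
        simp [this]
  rw [this]
  rfl

theorem eq_zero_of_forall_eval₂_zarembaK {k : ℕ} (hk : 2 ≤ k) {r : MvPolynomial (Fin 1) ℂ[X]}
    (h : ∀ z : ℂ, ‖z‖ < 1 →
      MvPolynomial.eval₂Hom (evalRingHom z) (fun _ => zarembaK k z) r = 0) : r = 0 := by
  by_contra hr
  refine zarembaK_transcendental hk (r := MvPolynomial.uniqueAlgEquiv ℂ[X] (Fin 1) r)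
    ((map_ne_zero_iff _ (AlgEquiv.injective _)).2 hr) fun z hz => ?_
  rw [← h z hz]
  have : (Polynomial.eval₂RingHom (evalRingHom z) (zarembaK k z)).comp
      (MvPolynomial.uniqueAlgEquiv ℂ[X] (Fin 1) : MvPolynomial (Fin 1) ℂ[X] →+* ℂ[X][X]) =
      MvPolynomial.eval₂Hom (evalRingHom z) (fun _ => zarembaK k z) := by
    refine MvPolynomial.ringHom_ext (fun f => ?_) fun i => ?_ <;> simp
  rw [← this]
  rfl

/-- As `K` is transcendental, the ideal of relations has height at most one: a prime relation
divides every relation. -/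
theorem prime_dvd_of_mem_relationIdeal {k : ℕ} (hk : 2 ≤ k) {p q : MvPolynomial (Fin 2) ℂ[X]}
    (hp : Prime p) (hpI : p ∈ relationIdeal k) (hqI : q ∈ relationIdeal k) : p ∣ q := by
  by_contra hpq
  set E := MvPolynomial.finSuccEquiv ℂ[X] 1 with hE
  have hirr : Irreducible (E p) := (MulEquiv.irreducible_iff E).2 hp.irreducible
  have heval : ∀ f ∈ relationIdeal k, ∀ z : ℂ, ‖z‖ < 1 → (E f).eval₂
      (MvPolynomial.eval₂Hom (evalRingHom z) fun _ => zarembaK k z) (zarembaM k z) = 0 := by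
    intro f hf z hz
    have := mem_relationIdeal.1 hf z hz
    rw [evalAt_eq_eval₂_finSuccEquiv] at this
    simpa [zarembaPair] using this
  by_cases hdeg : (E p).natDegree = 0
  · have hC := eq_C_of_natDegree_eq_zero hdeg
    have h0 : (E p).coeff 0 = 0 := by
      refine eq_zero_of_forall_eval₂_zarembaK hk fun z hz => ?_
      have := heval p hpI z hz
      rwa [hC, eval₂_C] at this
    rw [h0, C_0] at hC
    exact hirr.ne_zero hC
  · have hndvd : ¬E p ∣ E q := fun h => hpq ((map_dvd_iff E).1 h)
    obtain ⟨u, v, r, hr, huv⟩ := exists_bezout_eq_C hirr hdeg hndvd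
    refine hr (eq_zero_of_forall_eval₂_zarembaK hk fun z hz => ?_)
    have := congrArg (Polynomial.eval₂
      (MvPolynomial.eval₂Hom (evalRingHom z) fun _ => zarembaK k z) (zarembaM k z)) huv
    rw [eval₂_add, eval₂_mul, eval₂_mul, heval p hpI z hz, heval q hqI z hz, eval₂_C] at this
    simpa using this.symm

/-! ### Relations at `z ^ k` -/

theorem exists_residue_decomposition {k : ℕ} (hk : 0 < k) (f : ℂ[X]) :
    ∃ g : ℕ → ℂ[X], f = ∑ i ∈ Finset.range k, X ^ i * expand ℂ k (g i) := by
  induction f using Polynomial.induction_on' with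
  | add p q hp hq =>
    obtain ⟨g, hg⟩ := hp
    obtain ⟨g', hg'⟩ := hq
    refine ⟨fun i => g i + g' i, ?_⟩
    rw [hg, hg', ← Finset.sum_add_distrib]
    simp [mul_add]
  | monomial n a =>
    refine ⟨fun i => if i = n % k then monomial (n / k) a else 0, ?_⟩
    rw [Finset.sum_eq_single (n % k)]
    · dsimp only
      rw [if_pos rfl, expand_monomial, X_pow_mul_monomial, Nat.div_add_mod' n k]
    · intro i _ hi
      dsimp only
      rw [if_neg hi, map_zero, mul_zero]
    · intro h
      exact absurd (Finset.mem_range.2 (Nat.mod_lt _ hk)) h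

theorem exists_mv_residue_decomposition {k : ℕ} (hk : 0 < k) (q : MvPolynomial (Fin 2) ℂ[X]) :
    ∃ s : ℕ → MvPolynomial (Fin 2) ℂ[X],
      q = ∑ i ∈ Finset.range k, MvPolynomial.C (X ^ i) *
        MvPolynomial.map (expand ℂ k : ℂ[X] →+* ℂ[X]) (s i) ∧
      ∀ i, (s i).totalDegree ≤ q.totalDegree := by
  choose g hg using fun f : ℂ[X] => exists_residue_decomposition hk f
  refine ⟨fun i => ∑ m ∈ q.support, MvPolynomial.monomial m (g (q.coeff m) i), ?_, fun i => ?_⟩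
  · simp only [map_sum, MvPolynomial.map_monomial, Finset.mul_sum, MvPolynomial.C_mul_monomial]
    rw [Finset.sum_comm]
    conv_lhs => rw [MvPolynomial.as_sum q]
    refine Finset.sum_congr rfl fun m _ => ?_
    rw [← map_sum]
    congr 1
    exact hg _
  · refine MvPolynomial.totalDegree_finsetSum_le fun m hm => ?_
    exact (MvPolynomial.totalDegree_monomial_le _ _).trans (MvPolynomial.le_totalDegree hm)

theorem evalAt_map_expand (k : ℕ) (z : ℂ) (w : Fin 2 → ℂ) (p : MvPolynomial (Fin 2) ℂ[X]) :
    evalAt z w (MvPolynomial.map (expand ℂ k : ℂ[X] →+* ℂ[X]) p) = evalAt (z ^ k) w p := by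
  have : (evalAt z w).comp (MvPolynomial.map (expand ℂ k : ℂ[X] →+* ℂ[X])) = evalAt (z ^ k) w := by
    refine MvPolynomial.ringHom_ext (fun f => ?_) fun i => ?_
    · simp [expand_eval]
    · simp
  exact congrArg (fun φ => φ p) this

/-- A relation between `M(z ^ k)` and `K(z ^ k)` over `ℂ[z]` splits into relations between `M` and
`K`, according to the residues of the exponents of `z` modulo `k`: the polynomial in `T` with
coefficients the values of the parts vanishes at the `k` points `T` with `T ^ k = z ^ k`. -/
theorem mem_relationIdeal_of_residue_decomposition {k : ℕ} (hk : 2 ≤ k)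
    {s : ℕ → MvPolynomial (Fin 2) ℂ[X]}
    (h : ∀ z : ℂ, ‖z‖ < 1 → evalAt z (zarembaPair k (z ^ k)) (∑ i ∈ Finset.range k,
      MvPolynomial.C (X ^ i) * MvPolynomial.map (expand ℂ k : ℂ[X] →+* ℂ[X]) (s i)) = 0)
    {i : ℕ} (hi : i < k) : s i ∈ relationIdeal k := by
  have hk0 : k ≠ 0 := by omega
  have hne : ∀ w : ℂ, ‖w‖ < 1 → w ≠ 0 → evalAt w (zarembaPair k w) (s i) = 0 := by
    intro w hw hw0
    set f : ℂ[X] := ∑ i ∈ Finset.range k, C (evalAt w (zarembaPair k w) (s i)) * X ^ i with hf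
    have hroot : ∀ z : ℂ, z ^ k = w → f.eval z = 0 := by
      intro z hz
      have hz1 : ‖z‖ < 1 := by
        rw [← hz, norm_pow] at hw
        exact (pow_lt_one_iff_of_nonneg (norm_nonneg z) hk0).1 hw
      rw [← h z hz1]
      simp only [hf, eval_finsetSum, map_sum, map_mul, evalAt_C, evalAt_map_expand, hz, eval_mul,
        eval_C, eval_pow, eval_X]
      exact Finset.sum_congr rfl fun i _ => mul_comm _ _
    obtain ⟨z₀, hz₀⟩ := IsAlgClosed.exists_pow_nat_eq w (by omega : 0 < k)
    have hz₀0 : z₀ ≠ 0 := by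
      rintro rfl
      rw [zero_pow hk0] at hz₀
      exact hw0 hz₀.symm
    have hprim := Complex.isPrimitiveRoot_exp k hk0
    set ζ := Complex.exp (2 * Real.pi * Complex.I / k)
    have hf0 : f = 0 := by
      refine eq_zero_of_natDegree_lt_card_of_eval_eq_zero f (ι := Fin k)
        (f := fun j => ζ ^ (j : ℕ) * z₀) ?_ ?_ ?_
      · intro a b hab
        have := mul_right_cancel₀ hz₀0 hab
        exact Fin.ext (hprim.pow_inj a.2 b.2 this)
      · intro j
        refine hroot _ ?_
        rw [mul_pow, ← pow_mul, mul_comm, pow_mul', hprim.pow_eq_one, one_pow, mul_one, hz₀]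
      · rw [Fintype.card_fin]
        refine lt_of_le_of_lt (natDegree_sum_le_of_forall_le (n := k - 1) _ _ fun j hj => ?_)
          (by omega)
        have := Finset.mem_range.1 hj
        exact (natDegree_C_mul_X_pow_le _ _).trans (by omega)
    have := congrArg (fun f => coeff f i) hf0
    simpa [hf, finsetSum_coeff, coeff_X_pow, hi] using this
  rw [mem_relationIdeal]
  intro w hw
  by_cases hw0 : w = 0
  · -- continuity at the origin
    have hc : ContinuousAt (fun z => evalAt z (zarembaPair k z) (s i)) w :=
      ((analyticOnNhd_evalAt hk (s i)) w (by simpa using hw)).continuousAt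
    have h1 : Tendsto (fun z => evalAt z (zarembaPair k z) (s i)) (nhdsWithin w {w}ᶜ)
        (nhds (evalAt w (zarembaPair k w) (s i))) := hc.tendsto.mono_left nhdsWithin_le_nhds
    refine tendsto_nhds_unique h1 (tendsto_const_nhds.congr' ?_)
    have hball : Metric.ball (0 : ℂ) 1 ∈ nhds w :=
      Metric.isOpen_ball.mem_nhds (by simpa using hw)
    filter_upwards [self_mem_nhdsWithin, mem_nhdsWithin_of_mem_nhds hball] with z hz hz1
    exact (hne z (by simpa using hz1) (by simpa [hw0] using hz)).symm
  · exact hne w hw hw0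

theorem exists_eq_C_mul_map_expand {k : ℕ} (hk : 2 ≤ k) {p q : MvPolynomial (Fin 2) ℂ[X]}
    (hp : Prime p) (hpI : p ∈ relationIdeal k) (hdeg : q.totalDegree ≤ p.totalDegree)
    (hq : ∀ z : ℂ, ‖z‖ < 1 → evalAt z (zarembaPair k (z ^ k)) q = 0) :
    ∃ c : ℂ[X], q = MvPolynomial.C c * MvPolynomial.map (expand ℂ k : ℂ[X] →+* ℂ[X]) p := by
  obtain ⟨s, hs, hsdeg⟩ := exists_mv_residue_decomposition (by omega : 0 < k) q
  have hc : ∀ i ∈ Finset.range k, ∃ c : ℂ[X], s i = MvPolynomial.C c * p := by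
    intro i hi
    have hmem := mem_relationIdeal_of_residue_decomposition hk (s := s)
      (fun z hz => by rw [← hs]; exact hq z hz) (Finset.mem_range.1 hi)
    obtain ⟨t, ht⟩ := prime_dvd_of_mem_relationIdeal hk hp hpI hmem
    by_cases ht0 : t = 0
    · exact ⟨0, by rw [ht, ht0]; simp⟩
    · have h1 := MvPolynomial.totalDegree_mul_of_isDomain hp.ne_zero ht0
      rw [← ht] at h1
      have h2 := hsdeg i
      have h3 : t.totalDegree = 0 := by omega
      rw [MvPolynomial.totalDegree_eq_zero_iff_eq_C] at h3
      exact ⟨_, by rw [ht, mul_comm]; congr 1⟩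
  choose! c hc using hc
  refine ⟨∑ i ∈ Finset.range k, X ^ i * expand ℂ k (c i), ?_⟩
  rw [hs, map_sum, Finset.sum_mul]
  refine Finset.sum_congr rfl fun i hi => ?_
  rw [hc i hi, map_mul, MvPolynomial.map_C, map_mul, mul_assoc]
  rfl

/-! ### Leading forms of relations -/

theorem coeff_C_mul_linear_pow_mul_linear_pow {D : Type*} [CommRing D] {l₀ l₁ : D[X]}
    (h₀ : l₀.natDegree ≤ 1) (h₁ : l₁.natDegree ≤ 1) (c : D) {i j d : ℕ} (hd : i + j ≤ d) :
    (C c * (l₀ ^ i * l₁ ^ j)).coeff d =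
      if i + j = d then c * (l₀.coeff 1 ^ i * l₁.coeff 1 ^ j) else 0 := by
  have hi : (l₀ ^ i).natDegree ≤ i := by simpa using natDegree_pow_le_of_le i h₀
  have hj : (l₁ ^ j).natDegree ≤ j := by simpa using natDegree_pow_le_of_le j h₁
  rw [coeff_C_mul]
  split_ifs with h
  · rw [← h, coeff_mul_add_eq_of_natDegree_le hi hj]
    have := coeff_pow_of_natDegree_le (m := i) h₀
    rw [mul_one] at this
    rw [this]
    have := coeff_pow_of_natDegree_le (m := j) h₁
    rw [mul_one] at this
    rw [this]
  · rw [coeff_eq_zero_of_natDegree_lt, mul_zero]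
    exact lt_of_le_of_lt (natDegree_mul_le_of_le hi hj) (by omega)

/-- The exponent of `M ^ (d - j) K ^ j`. -/
noncomputable def formExponent (d j : ℕ) : Fin 2 →₀ ℕ :=
  Finsupp.single 0 (d - j) + Finsupp.single 1 j

@[simp]
theorem formExponent_zero (d j : ℕ) : formExponent d j 0 = d - j := by simp [formExponent]

@[simp]
theorem formExponent_one (d j : ℕ) : formExponent d j 1 = j := by simp [formExponent]

theorem sum_apply_le_totalDegree {D : Type*} [CommRing D] {p : MvPolynomial (Fin 2) D}
    {m : Fin 2 →₀ ℕ} (hm : m ∈ p.support) : m 0 + m 1 ≤ p.totalDegree := by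
  have := MvPolynomial.le_totalDegree hm
  rwa [Finsupp.sum_fintype _ _ (fun _ => rfl), Fin.sum_univ_two] at this

/-- Substituting polynomials of degree at most one for the variables, the coefficient in degree `d`
is the value of the leading form at the leading coefficients. -/
theorem coeff_eval₂_linear {D : Type*} [CommRing D] (p : MvPolynomial (Fin 2) D) {d : ℕ}
    (hd : p.totalDegree ≤ d) {l : Fin 2 → D[X]} (hl : ∀ i, (l i).natDegree ≤ 1) :
    (MvPolynomial.eval₂ C l p).coeff d = ∑ j ∈ Finset.range (d + 1),
      p.coeff (formExponent d j) * ((l 0).coeff 1 ^ (d - j) * (l 1).coeff 1 ^ j) := by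
  classical
  rw [MvPolynomial.eval₂_eq', finsetSum_coeff]
  have h1 : ∀ m ∈ p.support, (C (p.coeff m) * ∏ i, l i ^ m i).coeff d =
      if m 0 + m 1 = d then p.coeff m * ((l 0).coeff 1 ^ m 0 * (l 1).coeff 1 ^ m 1) else 0 := by
    intro m hm
    rw [Fin.prod_univ_two]
    exact coeff_C_mul_linear_pow_mul_linear_pow (hl 0) (hl 1) _
      ((sum_apply_le_totalDegree hm).trans hd)
  rw [Finset.sum_congr rfl h1]
  set g : (Fin 2 →₀ ℕ) → D := fun m =>
    if m 0 + m 1 = d then p.coeff m * ((l 0).coeff 1 ^ m 0 * (l 1).coeff 1 ^ m 1) else 0 with hg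
  set T := p.support ∪ (Finset.range (d + 1)).image (formExponent d) with hT
  have h2 : ∑ m ∈ p.support, g m = ∑ m ∈ T, g m := by
    refine Finset.sum_subset Finset.subset_union_left fun m _ hm => ?_
    rw [MvPolynomial.notMem_support_iff] at hm
    simp [hg, hm]
  have h3 : ∑ m ∈ (Finset.range (d + 1)).image (formExponent d), g m = ∑ m ∈ T, g m := by
    refine Finset.sum_subset Finset.subset_union_right fun m _ hm => ?_
    simp only [hg]
    rw [if_neg]
    intro hmd
    refine hm (Finset.mem_image.2 ⟨m 1, Finset.mem_range.2 (by omega), ?_⟩)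
    ext i
    fin_cases i
    · simp; omega
    · simp
  change ∑ m ∈ p.support, g m = _
  rw [h2, ← h3, Finset.sum_image]
  · refine Finset.sum_congr rfl fun j hj => ?_
    have := Finset.mem_range.1 hj
    simp only [hg, formExponent_zero, formExponent_one]
    rw [if_pos (by omega)]
  · intro i _ j _ hij
    simpa using congrArg (fun m => m 1) hij

theorem exists_coeff_formExponent_ne_zero {D : Type*} [CommRing D] {p : MvPolynomial (Fin 2) D}
    (hp : p ≠ 0) : ∃ j ≤ p.totalDegree, p.coeff (formExponent p.totalDegree j) ≠ 0 := by
  obtain ⟨m, hm, hmd⟩ := Finset.exists_mem_eq_sup p.support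
    (MvPolynomial.support_nonempty.2 hp) fun s => s.sum fun _ e => e
  have hd : p.totalDegree = m 0 + m 1 := by
    rw [MvPolynomial.totalDegree, hmd, Finsupp.sum_fintype _ _ (fun _ => rfl), Fin.sum_univ_two]
  refine ⟨m 1, by omega, ?_⟩
  have : formExponent p.totalDegree (m 1) = m := by
    ext i
    fin_cases i
    · simp [hd]
    · simp
  rw [this]
  exact MvPolynomial.mem_support_iff.1 hm

/-- The affine substitution `(M, K) ↦ (Q K - 1, P K + Q M)` expressing the values at `z` through
those at `z ^ k`. -/
noncomputable def mahlerSubst (k : ℕ) : Fin 2 → MvPolynomial (Fin 2) ℂ[X] :=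
  ![MvPolynomial.C (digitPoly k) * MvPolynomial.X 1 - 1,
    MvPolynomial.C (weightPoly k) * MvPolynomial.X 1 +
      MvPolynomial.C (digitPoly k) * MvPolynomial.X 0]

theorem totalDegree_mahlerSubst_le (k : ℕ) (i : Fin 2) : (mahlerSubst k i).totalDegree ≤ 1 := by
  have h : ∀ (f : ℂ[X]) (j : Fin 2),
      (MvPolynomial.C f * MvPolynomial.X j : MvPolynomial (Fin 2) ℂ[X]).totalDegree ≤ 1 := by
    intro f j
    refine (MvPolynomial.totalDegree_mul _ _).trans ?_
    rw [MvPolynomial.totalDegree_C, MvPolynomial.totalDegree_X]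
  fin_cases i
  · refine (MvPolynomial.totalDegree_sub _ _).trans (max_le (h _ _) ?_)
    rw [MvPolynomial.totalDegree_one]; exact zero_le_one
  · exact (MvPolynomial.totalDegree_add _ _).trans (max_le (h _ _) (h _ _))

theorem totalDegree_bind₁_le {D : Type*} [CommRing D] (p : MvPolynomial (Fin 2) D)
    {f : Fin 2 → MvPolynomial (Fin 2) D} (hf : ∀ i, (f i).totalDegree ≤ 1) :
    (MvPolynomial.bind₁ f p).totalDegree ≤ p.totalDegree := by
  rw [MvPolynomial.bind₁, MvPolynomial.aeval_def, MvPolynomial.eval₂_eq']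
  refine MvPolynomial.totalDegree_finsetSum_le fun m hm => ?_
  refine le_trans ?_ (sum_apply_le_totalDegree hm)
  refine (MvPolynomial.totalDegree_mul _ _).trans ?_
  rw [MvPolynomial.algebraMap_eq, MvPolynomial.totalDegree_C, zero_add, Fin.prod_univ_two]
  refine (MvPolynomial.totalDegree_mul _ _).trans (add_le_add ?_ ?_)
  · exact (MvPolynomial.totalDegree_pow _ _).trans (by simpa using Nat.mul_le_mul_left (m 0) (hf 0))
  · exact (MvPolynomial.totalDegree_pow _ _).trans (by simpa using Nat.mul_le_mul_left (m 1) (hf 1))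

theorem evalAt_bind₁_mahlerSubst {k : ℕ} (hk : 2 ≤ k) {z : ℂ} (hz : ‖z‖ < 1)
    (p : MvPolynomial (Fin 2) ℂ[X]) :
    evalAt z (zarembaPair k (z ^ k)) (MvPolynomial.bind₁ (mahlerSubst k) p) =
      evalAt z (zarembaPair k z) p := by
  have : (evalAt z (zarembaPair k (z ^ k))).comp
      (MvPolynomial.bind₁ (mahlerSubst k) : MvPolynomial (Fin 2) ℂ[X] →+* _) =
      evalAt z (zarembaPair k z) := by
    refine MvPolynomial.ringHom_ext (fun f => by simp) fun i => ?_
    fin_cases i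
    · simp [mahlerSubst, zarembaPair, zarembaM]
    · simp [mahlerSubst, zarembaPair, zarembaK_functional_equation hk hz]
  exact congrArg (fun φ => φ p) this

/-- The leading form of a prime relation would be a semi-invariant form. -/
theorem relationIdeal_eq_bot {k : ℕ} (hk : 2 ≤ k) : relationIdeal k = ⊥ := by
  by_contra hI
  obtain ⟨p, hpI, hp⟩ := (relationIdeal_isPrime hk).exists_mem_prime_of_ne_bot hI
  set d := p.totalDegree with hd
  have hd1 : 1 ≤ d := by
    by_contra hd0
    have h0 : p.totalDegree = 0 := by omega
    rw [MvPolynomial.totalDegree_eq_zero_iff_eq_C] at h0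
    have hfin := finite_setOfPred_isRoot (p := p.coeff 0) (by
      intro h; rw [h, map_zero] at h0; exact hp.ne_zero h0)
    refine infinite_of_mem_nhds (0 : ℂ) (Metric.ball_mem_nhds (0 : ℂ) one_pos) ?_
    refine hfin.subset fun z hz => ?_
    have := mem_relationIdeal.1 hpI z (by simpa using hz)
    rw [h0, evalAt_C] at this
    exact this
  obtain ⟨c, hc⟩ := exists_eq_C_mul_map_expand hk hp hpI
    (totalDegree_bind₁_le p (totalDegree_mahlerSubst_le k))
    fun z hz => by rw [evalAt_bind₁_mahlerSubst hk hz]; exact mem_relationIdeal.1 hpI z hz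
  refine no_semiinvariant_form hk hd1 (a := fun j => p.coeff (formExponent d j))
    (exists_coeff_formExponent_ne_zero hp.ne_zero) (c := c) fun u v => ?_
  -- restrict to the line through `(v, u)` and take coefficients in degree `d`
  have h1 := congrArg (fun q => (MvPolynomial.eval₂Hom C
    (![C (C v) * X, C (C u) * X] : Fin 2 → ℂ[X][X]) q).coeff d) hc
  have h2 : MvPolynomial.eval₂Hom C (![C (C v) * X, C (C u) * X] : Fin 2 → ℂ[X][X])
      (MvPolynomial.bind₁ (mahlerSubst k) p) = MvPolynomial.eval₂ C
      (![C (digitPoly k * C u) * X - 1, C (weightPoly k * C u + digitPoly k * C v) * X] :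
        Fin 2 → ℂ[X][X]) p := by
    have : (MvPolynomial.eval₂Hom C (![C (C v) * X, C (C u) * X] : Fin 2 → ℂ[X][X])).comp
        (MvPolynomial.bind₁ (mahlerSubst k) : MvPolynomial (Fin 2) ℂ[X] →+* _) =
        MvPolynomial.eval₂Hom C
        (![C (digitPoly k * C u) * X - 1, C (weightPoly k * C u + digitPoly k * C v) * X] :
        Fin 2 → ℂ[X][X]) := by
      refine MvPolynomial.ringHom_ext (fun f => by simp) fun i => ?_
      fin_cases i
      · simp [mahlerSubst, mul_assoc]
      · simp [mahlerSubst]; ring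
    exact congrArg (fun φ => φ p) this
  have hlindeg : ∀ f : ℂ[X], (C f * X : ℂ[X][X]).natDegree ≤ 1 := fun f =>
    (natDegree_C_mul_le _ _).trans natDegree_X_le
  have hmapdeg : (MvPolynomial.map (expand ℂ k : ℂ[X] →+* ℂ[X]) p).totalDegree ≤ d :=
    MvPolynomial.totalDegree_le_of_support_subset (MvPolynomial.support_map_subset _ _)
  rw [h2, map_mul (MvPolynomial.eval₂Hom C _), MvPolynomial.eval₂Hom_C, coeff_C_mul,
    coeff_eval₂_linear p hd.ge, MvPolynomial.coe_eval₂Hom, coeff_eval₂_linear _ hmapdeg] at h1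
  · have hlin : ∀ (f : ℂ[X]), (C f * X : ℂ[X][X]).coeff 1 = f := fun f => by simp
    have hlin' : ∀ (f : ℂ[X]), (C f * X - 1 : ℂ[X][X]).coeff 1 = f := fun f => by simp [coeff_one]
    simp only [MvPolynomial.coeff_map, cons_val_zero, cons_val_one, hlin, hlin'] at h1
    refine (Eq.trans (Finset.sum_congr rfl fun j _ => by ring) h1).trans ?_
    refine congrArg (c * ·) (Finset.sum_congr rfl fun j _ => ?_)
    rw [C_mul, C_pow, C_pow, mul_comm (C u ^ j)]
    rfl
  · intro i
    fin_cases i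
    · exact hlindeg (C v)
    · exact hlindeg (C u)
  · intro i
    fin_cases i
    · exact natDegree_sub_le_of_le (hlindeg (digitPoly k * C u))
        (natDegree_one.trans_le zero_le_one)
    · exact hlindeg (weightPoly k * C u + digitPoly k * C v)

/-! ### Passage to functions on the disc -/

theorem ratFuncToDisc_algebraMap (f : ℂ[X]) :
    algebraMap (RatFunc ℂ) DiscFunction (algebraMap ℂ[X] (RatFunc ℂ) f) =
      ((fun z : ℂ => f.eval z : ℂ → ℂ) : DiscFunction) := by
  change ((fun z : ℂ => (algebraMap ℂ[X] (RatFunc ℂ) f).eval (RingHom.id ℂ) z : ℂ → ℂ) :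
    DiscFunction) = _
  congr 1
  funext z
  rw [RatFunc.eval_algebraMap]
  simp

theorem aeval_discFunction_map (k : ℕ) (p : MvPolynomial (Fin 2) ℂ[X]) :
    MvPolynomial.aeval
      ![((fun z : ℂ => zarembaM k z : ℂ → ℂ) : DiscFunction),
        ((fun z : ℂ => zarembaK k z : ℂ → ℂ) : DiscFunction)]
      (MvPolynomial.map (algebraMap ℂ[X] (RatFunc ℂ)) p) =
    ((fun z : ℂ => evalAt z (zarembaPair k z) p : ℂ → ℂ) : DiscFunction) := by
  induction p using MvPolynomial.induction_on with
  | C f =>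
    rw [MvPolynomial.map_C, MvPolynomial.aeval_C, ratFuncToDisc_algebraMap]
    simp only [evalAt_C]
  | add p q hp hq =>
    simp only [map_add, hp, hq]
    rfl
  | mul_X p i hp =>
    simp only [map_mul, hp, MvPolynomial.map_X, MvPolynomial.aeval_X, evalAt_X]
    fin_cases i <;> rfl

theorem eq_zero_of_aeval_discFunction_eq_zero {k : ℕ} (hk : 2 ≤ k)
    {p : MvPolynomial (Fin 2) ℂ[X]}
    (h : ((fun z : ℂ => evalAt z (zarembaPair k z) p : ℂ → ℂ) : DiscFunction) = 0) : p = 0 := by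
  have hmem : p ∈ relationIdeal k := by
    rw [mem_relationIdeal]
    intro z hz
    have hzb : z ∈ Metric.ball (0 : ℂ) 1 := by simpa using hz
    have h1 : ∀ᶠ w in codiscreteWithin (Metric.ball (0 : ℂ) 1),
        evalAt w (zarembaPair k w) p = 0 := Germ.coe_eq.1 h
    have h2 := mem_codiscreteWithin_iff_forall_mem_nhdsNE.1 h1 z hzb
    have hc : Tendsto (fun w => evalAt w (zarembaPair k w) p) (nhdsWithin z {z}ᶜ)
        (nhds (evalAt z (zarembaPair k z) p)) :=
      (analyticOnNhd_evalAt hk p z hzb).continuousAt.tendsto.mono_left nhdsWithin_le_nhds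
    refine tendsto_nhds_unique hc (tendsto_const_nhds.congr' ?_)
    filter_upwards [h2, mem_nhdsWithin_of_mem_nhds (Metric.isOpen_ball.mem_nhds hzb)] with w hw hwb
    exact (hw.resolve_right fun hn => hn hwb).symm
  rwa [relationIdeal_eq_bot hk, Ideal.mem_bot] at hmem

attribute [local instance] MvPolynomial.algebraMvPolynomial in
theorem algebraicIndependent_zarembaPair {k : ℕ} (hk : 2 ≤ k) :
    AlgebraicIndependent (RatFunc ℂ)
      ![((fun z : ℂ => zarembaM k z : ℂ → ℂ) : DiscFunction),
        ((fun z : ℂ => zarembaK k z : ℂ → ℂ) : DiscFunction)] := by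
  rw [algebraicIndependent_iff]
  intro (p : MvPolynomial (Fin 2) (RatFunc ℂ)) hp
  -- clear denominators
  obtain ⟨⟨N, ⟨s, hs⟩⟩, hN⟩ := IsLocalization.surj
    ((nonZeroDivisors ℂ[X]).map (MvPolynomial.C (σ := Fin 2))) p
  obtain ⟨b, hb, rfl⟩ := hs
  have hN' : p * MvPolynomial.map (algebraMap ℂ[X] (RatFunc ℂ)) (MvPolynomial.C b) =
      MvPolynomial.map (algebraMap ℂ[X] (RatFunc ℂ)) N := hN
  have h0 : N = 0 := by
    refine eq_zero_of_aeval_discFunction_eq_zero hk ?_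
    rw [← aeval_discFunction_map, ← hN', map_mul, hp, zero_mul]
  rw [h0, map_zero, MvPolynomial.map_C] at hN'
  refine (mul_eq_zero.1 hN').resolve_right ?_
  simpa using nonZeroDivisors.ne_zero hb

theorem algebraicIndependent_zarembaK {k : ℕ} (hk : 2 ≤ k) :
    AlgebraicIndependent (RatFunc ℂ)
      ![((fun z : ℂ => zarembaK k z : ℂ → ℂ) : DiscFunction),
        ((fun z : ℂ => zarembaK k (z ^ k) : ℂ → ℂ) : DiscFunction)] := by
  set q : RatFunc ℂ := algebraMap ℂ[X] (RatFunc ℂ) (digitPoly k) with hq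
  have hq0 : q ≠ 0 := by
    simpa [hq] using (digitPoly_monic (by omega : k ≠ 0)).ne_zero
  have hM : ((fun z : ℂ => zarembaM k z : ℂ → ℂ) : DiscFunction) + 1 =
      algebraMap (RatFunc ℂ) DiscFunction q *
        ((fun z : ℂ => zarembaK k (z ^ k) : ℂ → ℂ) : DiscFunction) := by
    rw [hq, ratFuncToDisc_algebraMap]
    change ((fun z : ℂ => zarembaM k z + 1 : ℂ → ℂ) : DiscFunction) = ((fun z : ℂ =>
      (digitPoly k).eval z * zarembaK k (z ^ k) : ℂ → ℂ) : DiscFunction)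
    simp [zarembaM]
  rw [algebraicIndependent_iff]
  intro (p : MvPolynomial (Fin 2) (RatFunc ℂ)) hp
  -- the substitution `K(z ^ k) = (M + 1) / Q`, and its inverse `M = Q K(z ^ k) - 1`
  set f : Fin 2 → MvPolynomial (Fin 2) (RatFunc ℂ) :=
    ![MvPolynomial.X 1, MvPolynomial.C q⁻¹ * (MvPolynomial.X 0 + 1)] with hf
  set g : Fin 2 → MvPolynomial (Fin 2) (RatFunc ℂ) :=
    ![MvPolynomial.C q * MvPolynomial.X 1 - 1, MvPolynomial.X 0] with hg
  have hgf : ∀ i, MvPolynomial.bind₁ g (f i) = MvPolynomial.X i := by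
    intro i
    fin_cases i
    · simp [hf, hg]
    · simp [hf, hg, ← mul_assoc, ← MvPolynomial.C_mul, hq0]
  have hinv : MvPolynomial.bind₁ g (MvPolynomial.bind₁ f p) = p := by
    rw [MvPolynomial.bind₁_bind₁]
    simp only [hgf]
    simp
  have h0 : MvPolynomial.bind₁ f p = 0 := by
    refine algebraicIndependent_iff.1 (algebraicIndependent_zarembaPair hk) _ ?_
    rw [MvPolynomial.aeval_bind₁, ← hp]
    congr 2
    funext i
    fin_cases i
    · simp [hf]
    · change MvPolynomial.aeval _ (MvPolynomial.C q⁻¹ * (MvPolynomial.X 0 + 1)) = _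
      rw [map_mul, map_add, MvPolynomial.aeval_C, MvPolynomial.aeval_X, map_one]
      change _ * (((fun z : ℂ => zarembaM k z : ℂ → ℂ) : DiscFunction) + 1) = _
      rw [hM, ← mul_assoc, ← map_mul, inv_mul_cancel₀ hq0, map_one, one_mul]
      rfl
  rw [← hinv, h0, map_zero]

end Zaremba

theorem mainTheorem1 (k : ℕ) (hk : 2 ≤ k) :
    (∀ z : ℂ, ‖z‖ < 1 → Summable fun n : ℕ => (kappa k n : ℂ) * z ^ n) ∧
    AlgebraicIndependent (RatFunc ℂ)
      ![((fun z : ℂ => zarembaK k z : ℂ → ℂ) : DiscFunction),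
        ((fun z : ℂ => zarembaK k (z ^ k) : ℂ → ℂ) : DiscFunction)] :=
  ⟨fun _ hz => Zaremba.summable_mul_pow (Zaremba.norm_kappa_le hk) hz,
    Zaremba.algebraicIndependent_zarembaK hk⟩
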